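/- For a finite rooted ordered tree $T$ let $|T|$ be its number of vertices, let $\rho(T)$ be its number of subtrees (subgraphs that are trees, hence nonempty), and let $\rho_1(T)$ and $\rho_2(T)$ be the numbers of subtrees that contain, respectively do not contain, the root of $T$. Put $\mathrm{RR}_{ij}(z)=\sum_T \rho_i(T)\rho_j(T)z^{|T|}$, where the sum is over all finite rooted ordered trees, and $\mathrm{RR}(z)=\mathrm{RR}_{11}(z)+2\,\mathrm{RR}_{12}(z)+\mathrm{RR}_{22}(z)$. Let $T_n$ be chosen uniformly at random from the rooted ordered trees with $n$ vertices, let $\rho_n=\rho(T_n)$, and let $z_0=\frac{8}{81}$. Then: 1. The series $\mathrm{RR}_{11}(z)$, $\mathrm{RR}_{12}(z)$ and $\mathrm{RR}_{22}(z)$ converge absolutely for $|z|<z_0$, and $z_0$ is the smallest singularity of both $\mathrm{RR}_{11}$ and $\mathrm{RR}$: these functions are analytic in the disc $|z|<z_0$, they extend analytically to a neighbourhood of every point of the circle $|z|=z_0$ other than $z_0$, and they do not extend analytically to a neighbourhood of $z_0$. 2. Both functions have a square-root expansion at $z_0$: for $z$ near $z_0$ with $|z|<z_0$ each of them is a convergent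 power series in $\sqrt{1-z/z_0}$ (principal branch), which starts with $$\mathrm{RR}_{11}(z)=\frac{2\sqrt2}{9}-\frac{4}{3\sqrt7}\sqrt{1-\frac{z}{z_0}}+O\left(1-\frac{z}{z_0}\right),$$ $$\mathrm{RR}(z)=\frac{2432\sqrt2-1632}{3087}-\frac{32\sqrt{14}}{147}\sqrt{1-\frac{z}{z_0}}+O\left(1-\frac{z}{z_0}\right).$$ 3. As $n\to\infty$, $$\operatorname{Var}(\rho_n)\sim\frac{64\sqrt{14}}{147}\left(\frac{81}{32}\right)^n.$$ -/

import Mathlib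

open Filter Topology MeasureTheory ProbabilityTheory Asymptotics

/-- Rooted ordered (plane) trees: a root together with a finite sequence of branches. -/
inductive PlaneTree : Type
  | node (k : ℕ) (branch : Fin k → PlaneTree) : PlaneTree

namespace PlaneTree

/-- The vertices of a rooted ordered tree: the root, and the vertices of its branches. -/
inductive Vertex : PlaneTree → Type
  | root (T : PlaneTree) : Vertex T
  | inBranch {k : ℕ} {branch : Fin k → PlaneTree} (i : Fin k) (v : Vertex (branch i)) :
      Vertex (node k branch)

/-- `IsParent u v`: the vertex `u` is the parent of the vertex `v`. -/
inductive IsParent : {T : PlaneTree} → Vertex T → Vertex T → Prop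
  | root {k : ℕ} {branch : Fin k → PlaneTree} (i : Fin k) :
      IsParent (Vertex.root (node k branch)) (Vertex.inBranch i (Vertex.root (branch i)))
  | inBranch {k : ℕ} {branch : Fin k → PlaneTree} (i : Fin k) {u v : Vertex (branch i)} :
      IsParent u v →
        IsParent (T := node k branch) (Vertex.inBranch i u) (Vertex.inBranch i v)

/-- The underlying graph of a rooted ordered tree: edges join each vertex to its children. -/
def graph (T : PlaneTree) : SimpleGraph (Vertex T) :=
  SimpleGraph.fromRel IsParent

/-- A vertex of a tree is its root or lies in exactly one of the branches. -/
def vertexEquiv (k : ℕ) (branch : Fin k → PlaneTree) :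
    Vertex (node k branch) ≃ Option (Σ i, Vertex (branch i)) where
  toFun
    | .root _ => none
    | .inBranch i v => some ⟨i, v⟩
  invFun
    | none => .root _
    | some ⟨i, v⟩ => .inBranch i v
  left_inv v := by cases v <;> rfl
  right_inv v := by rcases v with _ | ⟨i, v⟩ <;> rfl

theorem finite_vertex (T : PlaneTree) : Finite (Vertex T) := by
  induction T with
  | node k branch ih => exact Finite.of_equiv _ (vertexEquiv k branch).symm

/-- `|T|`, the number of vertices of `T`. -/
noncomputable def order (T : PlaneTree) : ℕ := Nat.card (Vertex T)

theorem order_node (k : ℕ) (branch : Fin k → PlaneTree) :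
    (node k branch).order = 1 + ∑ i, (branch i).order := by
  have := fun i => finite_vertex (branch i)
  rw [order, Nat.card_congr (vertexEquiv k branch), Finite.card_option, Nat.card_sigma, add_comm]
  rfl

/-- There are only finitely many rooted ordered trees on `n` vertices. -/
theorem finite_setOf_order_eq (n : ℕ) : {T : PlaneTree | T.order = n}.Finite := by
  suffices h : {T : PlaneTree | T.order ≤ n}.Finite from h.subset fun T hT => le_of_eq hT
  induction n with
  | zero =>
    convert Set.finite_empty
    ext ⟨k, branch⟩
    simp [order_node]
  | succ n ih =>
    refine ((Set.finite_le_nat n).biUnion fun k _ =>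
      (Set.Finite.pi' fun _ : Fin k => ih).image (node k)).subset ?_
    rintro ⟨k, branch⟩ h
    simp only [Set.mem_ofPred_eq, order_node] at h
    have hpos (T : PlaneTree) : 1 ≤ T.order := by
      obtain ⟨k, b⟩ := T
      simp [order_node]
    have hk : k ≤ ∑ i, (branch i).order := by
      simpa using Finset.sum_le_sum fun i (_ : i ∈ Finset.univ) => hpos (branch i)
    refine Set.mem_biUnion (show k ≤ n by omega) ⟨branch, fun i => ?_, rfl⟩
    have := Finset.single_le_sum (f := fun i => (branch i).order)
      (fun _ _ => Nat.zero_le _) (Finset.mem_univ i)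
    simp only [Set.mem_ofPred_eq] at this ⊢
    omega

/-- The `ρ`-index: the number of subtrees, i.e. of subgraphs that are trees. -/
noncomputable def rho (T : PlaneTree) : ℕ :=
  Nat.card {H : T.graph.Subgraph // H.coe.IsTree}

/-- The number of subtrees that contain the root. -/
noncomputable def rho₁ (T : PlaneTree) : ℕ :=
  Nat.card {H : T.graph.Subgraph // H.coe.IsTree ∧ Vertex.root T ∈ H.verts}

/-- The number of subtrees that do not contain the root. -/
noncomputable def rho₂ (T : PlaneTree) : ℕ :=
  Nat.card {H : T.graph.Subgraph // H.coe.IsTree ∧ Vertex.root T ∉ H.verts}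

instance : MeasurableSpace PlaneTree := ⊤

instance : DiscreteMeasurableSpace PlaneTree := ⟨fun _ => trivial⟩

/-- `Var(ρ_n)`, where `ρ_n = ρ(T_n)` for a uniformly random rooted ordered tree `T_n` on
`n` vertices. -/
noncomputable def varRho (n : ℕ) : ℝ :=
  variance (fun T : PlaneTree => (T.rho : ℝ)) (uniformOn {T : PlaneTree | T.order = n})

/-- The terms `X(T) Y(T) z^|T|` of the generating function for the indices `X` and `Y`. -/
noncomputable def genTerm (X Y : PlaneTree → ℕ) (z : ℂ) (T : PlaneTree) : ℂ :=
  (X T : ℂ) * (Y T : ℂ) * z ^ T.order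

noncomputable def RR₁₁ (z : ℂ) : ℂ := ∑' T, genTerm rho₁ rho₁ z T

noncomputable def RR₁₂ (z : ℂ) : ℂ := ∑' T, genTerm rho₁ rho₂ z T

noncomputable def RR₂₂ (z : ℂ) : ℂ := ∑' T, genTerm rho₂ rho₂ z T

/-- `RR(z) = RR₁₁(z) + 2 RR₁₂(z) + RR₂₂(z)`. -/
noncomputable def RR (z : ℂ) : ℂ := RR₁₁ z + 2 * RR₁₂ z + RR₂₂ z

end PlaneTree

/-- The function `f`, considered on the disc `|z| < |w|`, extends analytically to a
neighbourhood of the boundary point `w`. -/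
def ExtendsAnalyticallyAt (f : ℂ → ℂ) (w : ℂ) : Prop :=
  ∃ g : ℂ → ℂ, AnalyticAt ℂ g w ∧ ∀ᶠ z in 𝓝[Metric.ball 0 ‖w‖] w, f z = g z

/-- `z₀` is the smallest singularity of `f`: the function `f` is analytic in the disc
`|z| < |z₀|`, it does not extend analytically to a neighbourhood of `z₀`, and it does so at all
other points of the circle `|z| = |z₀|`. Nothing is said about the values of `f` outside
of the disc. -/
structure IsSmallestSingularity (f : ℂ → ℂ) (z₀ : ℂ) : Prop where
  analytic : AnalyticOnNhd ℂ f (Metric.ball 0 ‖z₀‖)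
  singular : ¬ ExtendsAnalyticallyAt f z₀
  regular : ∀ w : ℂ, ‖w‖ = ‖z₀‖ → w ≠ z₀ → ExtendsAnalyticallyAt f w

/-- `f` has a square-root expansion `f(z) = a + b √(1 - z/z₀) + O(1 - z/z₀)` at the point `z₀`
of the boundary of the disc `|z| < |z₀|`: near `z₀`, it is given by a convergent power series in
`√(1 - z/z₀)` (principal branch) that starts with `a + b √(1 - z/z₀)`. -/
def HasSqrtExpansion (f : ℂ → ℂ) (z₀ a b : ℂ) : Prop :=
  ∃ g : ℂ → ℂ, AnalyticAt ℂ g 0 ∧ g 0 = a ∧ deriv g 0 = b ∧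
    ∀ᶠ z in 𝓝[Metric.ball 0 ‖z₀‖] z₀, f z = g ((1 - z / z₀) ^ (1 / 2 : ℂ))

/-!
Every rooted ordered tree is either a single vertex or arises from a tree `b` by attaching a tree
`a` as a new first branch to the root of `b`; the result is `graft a b`. Its graph consists of the
graphs of `a` and `b`, joined by an edge between the two roots. Since the graphs are acyclic,
subtrees correspond to connected vertex sets, and counting these in a join gives
`ρ₁ (graft a b) = (1 + ρ₁ a) ρ₁ b` and `ρ₂ (graft a b) = ρ a + ρ₂ b`
(`rho₁_graft`, `rho₂_graft`).

Hence the generating functions `C`, `R₁`, `R₂`, `RR₁₁`, `RR₁₂`, `RR₂₂` of `1`, `ρ₁`, `ρ₂`, `ρ₁²`,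
`ρ₁ρ₂`, `ρ₂²` satisfy polynomial equations with nonnegative coefficients, for instance
`C = z + C²`, `R₁ = z + (C + R₁) R₁` and `RR₁₁ = z + (C + 2 R₁ + RR₁₁) RR₁₁`. A nonnegative
solution at some `r > 0` bounds all partial sums (`summable_and_tsum_le`). This gives absolute
convergence of `C`, `R₁`, `R₂` for `|z| ≤ 4/25`, and of the other functions for `|z| ≤ 8/81`.

Put `U = 1 - C - 2 R₁` (`discRoot`). The equations give `U² = (1 - C)(1 - 5C)` and
`(U - 2 RR₁₁)² = (1 - C)(1 - 9C)`. As `(1 - 9C)(8 - 9C) = 8 (1 - z/z₀)` for `z₀ = 8/81`,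
`U - 2 RR₁₁ = G √(1 - z/z₀)` with `G = √(8 (1 - C)/(8 - 9C))` (`sqrtFactor`), where `U` and `G`
are analytic in the disc `|z| < 4/25`, which contains `z₀`; the sign of the root is determined by
the bounds for the generating functions. The equations for `RR₁₂` and `RR₂₂` are linear, so `RR`
has the form `E(z) + F(z) √(1 - z/z₀)` as well (`hasSqrtForm_RR₁₁`, `hasSqrtForm_RR`). The
statements on singularities and expansions hold for each function of this form with `F(z₀) ≠ 0`.

Finally `√(1 - z/z₀) = 1 - 2 C(81z/32)`, so the coefficients of `RR` are, up to a term of smaller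
exponential order, `-2` times convolutions of those of `F` with `c_n (81/32)^n`, where `c_n` is the
number of trees with `n` vertices, a Catalan number. By dominated convergence, the `n`-th
coefficient divided by `c_n (81/32)^n` tends to `-2 F(z₀)` (`HasSqrtForm.tendsto_coeff`). This
gives the second moment of `ρ_n`. The squared mean is negligible: it is at most `(25/16)^(2n)`, up
to a polynomial factor.
-/

/-! ### Connected vertex sets and joins of graphs -/

namespace SimpleGraph

variable {V W : Type*}

/-- A map that sends edges to edges or collapses them preserves reachability. -/
theorem Reachable.map_of_eq_or_adj {G : SimpleGraph V} {H : SimpleGraph W} {f : V → W}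
    (hf : ∀ x y, G.Adj x y → f x = f y ∨ H.Adj (f x) (f y)) {x y : V} (h : G.Reachable x y) :
    H.Reachable (f x) (f y) := by
  obtain ⟨p⟩ := h
  induction p with
  | nil => exact Reachable.rfl
  | cons hadj _ ih =>
    rcases hf _ _ hadj with h | h
    · rwa [h]
    · exact h.reachable.trans ih

/-- The vertex sets of the connected induced subgraphs of `G`. -/
def connectedSets (G : SimpleGraph V) : Set (Set V) :=
  {s | (G.induce s).Connected}

theorem mem_connectedSets_iff {G : SimpleGraph V} {s : Set V} :
    s ∈ G.connectedSets ↔ s.Nonempty ∧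
      ∀ (x y : V) (hx : x ∈ s) (hy : y ∈ s), (G.induce s).Reachable ⟨x, hx⟩ ⟨y, hy⟩ := by
  simp only [connectedSets, Set.mem_ofPred_eq, connected_iff, Preconnected, Subtype.forall,
    Set.nonempty_coe_sort]
  exact ⟨fun h => ⟨h.2, fun x y hx hy => h.1 x hx y hy⟩,
    fun h => ⟨fun x hx y hy => h.2 x y hx hy, h.1⟩⟩

/-- In an acyclic graph, the subgraphs that are trees correspond to the connected vertex sets. -/
theorem IsAcyclic.card_subtrees {G : SimpleGraph V} (hG : G.IsAcyclic) (p : Set V → Prop) :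
    Nat.card {H : G.Subgraph // H.coe.IsTree ∧ p H.verts} =
      {s | s ∈ G.connectedSets ∧ p s}.ncard := by
  -- An edge between two vertices of a subtree is the only path between them, so it is in the
  -- subtree: subtrees are induced.
  have key (H : G.Subgraph) (hH : H.coe.Connected) {x y : V} (hx : x ∈ H.verts)
      (hy : y ∈ H.verts) (hxy : G.Adj x y) : H.Adj x y := by
    by_contra hn
    have hb := (isAcyclic_iff_forall_adj_isBridge.1 hG) hxy
    rw [isBridge_iff] at hb
    refine hb ?_
    refine (hH.preconnected ⟨x, hx⟩ ⟨y, hy⟩).map_of_eq_or_adj (f := Subtype.val) ?_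
    rintro ⟨a, ha⟩ ⟨b, hb'⟩ hab
    right
    rw [Subgraph.coe_adj] at hab
    simp only [deleteEdges_adj, Set.mem_singleton_iff, Sym2.eq_iff]
    refine ⟨hab.adj_sub, ?_⟩
    rintro (⟨rfl, rfl⟩ | ⟨rfl, rfl⟩)
    · exact hn hab
    · exact hn hab.symm
  have hind (H : G.Subgraph) (hH : H.coe.Connected) : H.coe = G.induce H.verts := by
    ext ⟨x, hx⟩ ⟨y, hy⟩
    simp only [Subgraph.coe_adj, comap_adj, Function.Embedding.subtype_apply]
    exact ⟨fun h => h.adj_sub, fun h => key H hH hx hy h⟩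
  refine Nat.card_congr (β := {s | s ∈ G.connectedSets ∧ p s}) (Equiv.ofBijective
    (fun H => ⟨H.1.verts, ?_, H.2.2⟩) ⟨?_, ?_⟩)
  · have h := H.2.1.connected
    rwa [hind _ h] at h
  · rintro ⟨H, hH, _⟩ ⟨K, hK, _⟩ h
    have h' : H.verts = K.verts := congrArg Subtype.val h
    refine Subtype.ext (Subgraph.ext h' ?_)
    ext x y
    constructor
    · intro hxy
      exact key K hK.connected (h' ▸ hxy.fst_mem) (h' ▸ hxy.snd_mem) hxy.adj_sub
    · intro hxy
      exact key H hH.connected (h'.symm ▸ hxy.fst_mem) (h'.symm ▸ hxy.snd_mem) hxy.adj_sub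
  · rintro ⟨s, hs, hp⟩
    refine ⟨⟨(⊤ : G.Subgraph).induce s, ⟨?_, ?_⟩, hp⟩, rfl⟩
    · have : (G.induce s).Connected := hs
      rwa [induce_eq_coe_induce_top] at this
    · exact hG.subgraph _

/-- The graph obtained from the disjoint union of `G` and `H` by adding an edge between the
vertex `u` of `G` and the vertex `v` of `H`. -/
def joinByEdge (G : SimpleGraph V) (H : SimpleGraph W) (u : V) (v : W) : SimpleGraph (V ⊕ W) where
  Adj
    | .inl x, .inl y => G.Adj x y
    | .inr x, .inr y => H.Adj x y
    | .inl x, .inr y => x = u ∧ y = v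
    | .inr x, .inl y => x = v ∧ y = u
  symm := by
    constructor
    rintro (x | x) (y | y) h
    · exact G.adj_symm h
    · exact h.symm
    · exact h.symm
    · exact H.adj_symm h
  loopless := by
    constructor
    rintro (x | x) h
    · exact G.loopless.1 x h
    · exact H.loopless.1 x h

section joinByEdge

variable {G : SimpleGraph V} {H : SimpleGraph W} {u : V} {v : W}

@[simp] theorem joinByEdge_inl_inl {x y : V} :
    (joinByEdge G H u v).Adj (.inl x) (.inl y) ↔ G.Adj x y := Iff.rfl

@[simp] theorem joinByEdge_inr_inr {x y : W} :
    (joinByEdge G H u v).Adj (.inr x) (.inr y) ↔ H.Adj x y := Iff.rfl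

@[simp] theorem joinByEdge_inl_inr {x : V} {y : W} :
    (joinByEdge G H u v).Adj (.inl x) (.inr y) ↔ x = u ∧ y = v := Iff.rfl

@[simp] theorem joinByEdge_inr_inl {x : W} {y : V} :
    (joinByEdge G H u v).Adj (.inr x) (.inl y) ↔ x = v ∧ y = u := Iff.rfl

/-- Joining two acyclic graphs by an edge gives an acyclic graph: each edge remains a bridge,
as collapsing one of the two sides to the end of the new edge shows. -/
theorem IsAcyclic.joinByEdge (hG : G.IsAcyclic) (hH : H.IsAcyclic) (u : V) (v : W) :
    (joinByEdge G H u v).IsAcyclic := by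
  rw [isAcyclic_iff_forall_adj_isBridge] at *
  have hmix {x : V} {y : W} (hx : x = u) (hy : y = v) :
      ¬ ((SimpleGraph.joinByEdge G H u v).deleteEdges {s(.inl x, .inr y)}).Reachable
        (.inl x) (.inr y) := by
    subst hx hy
    intro h
    have := h.map_of_eq_or_adj (H := (⊥ : SimpleGraph Bool)) (f := Sum.isLeft) (by
      rintro (a | a) (b | b) <;> simp)
    simp at this
  rintro (x | x) (y | y) hxy
  · rw [joinByEdge_inl_inl] at hxy
    have hb := hG hxy
    rw [isBridge_iff] at hb ⊢
    refine fun h => hb ?_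
    refine h.map_of_eq_or_adj (f := Sum.elim id fun _ => u) ?_
    rintro (a | a) (b | b) <;> simp +contextual
  · rw [isBridge_iff]
    exact hmix hxy.1 hxy.2
  · rw [isBridge_iff]
    refine fun h => hmix hxy.2 hxy.1 ?_
    rw [Sym2.eq_swap]
    exact h.symm
  · rw [joinByEdge_inr_inr] at hxy
    have hb := hH hxy
    rw [isBridge_iff] at hb ⊢
    refine fun h => hb ?_
    refine h.map_of_eq_or_adj (f := Sum.elim (fun _ => v) id) ?_
    rintro (a | a) (b | b) <;> simp +contextual

/-- The image of a connected set under a map that sends edges to edges or collapses them is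
connected. -/
theorem image_mem_connectedSets {s : Set V} (hs : s ∈ G.connectedSets) (f : V → W)
    (hf : ∀ x ∈ s, ∀ y ∈ s, G.Adj x y → f x = f y ∨ H.Adj (f x) (f y)) :
    f '' s ∈ H.connectedSets := by
  rw [mem_connectedSets_iff] at hs ⊢
  refine ⟨hs.1.image f, ?_⟩
  rintro _ _ ⟨x, hx, rfl⟩ ⟨y, hy, rfl⟩
  refine (hs.2 x y hx hy).map_of_eq_or_adj
    (f := fun z : s => (⟨f z, Set.mem_image_of_mem f z.2⟩ : (f '' s : Set W))) ?_
  rintro ⟨a, ha⟩ ⟨b, hb⟩ hab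
  simpa using hf a ha b hb hab

theorem inl_image_mem_connectedSets_iff {s : Set V} :
    (Sum.inl '' s : Set (V ⊕ W)) ∈ (joinByEdge G H u v).connectedSets ↔
      s ∈ G.connectedSets := by
  refine ⟨fun h => ?_, fun h => image_mem_connectedSets h _ fun x _ y _ hxy => Or.inr hxy⟩
  have := image_mem_connectedSets (H := G) h (Sum.elim id fun _ => u) (by
    rintro _ ⟨x, hx, rfl⟩ _ ⟨y, hy, rfl⟩ hxy
    exact Or.inr hxy)
  simpa [Set.image_image] using this

theorem inr_image_mem_connectedSets_iff {t : Set W} :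
    (Sum.inr '' t : Set (V ⊕ W)) ∈ (joinByEdge G H u v).connectedSets ↔
      t ∈ H.connectedSets := by
  refine ⟨fun h => ?_, fun h => image_mem_connectedSets h _ fun x _ y _ hxy => Or.inr hxy⟩
  have := image_mem_connectedSets (H := H) h (Sum.elim (fun _ => v) id) (by
    rintro _ ⟨x, hx, rfl⟩ _ ⟨y, hy, rfl⟩ hxy
    exact Or.inr hxy)
  simpa [Set.image_image] using this

/-- A set that meets both sides of a join is connected if and only if it contains the two ends
of the new edge and its two parts are connected. -/
theorem union_mem_connectedSets_iff {s : Set V} {t : Set W} (hs : s.Nonempty)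
    (ht : t.Nonempty) :
    (Sum.inl '' s ∪ Sum.inr '' t : Set (V ⊕ W)) ∈ (joinByEdge G H u v).connectedSets ↔
      (s ∈ G.connectedSets ∧ u ∈ s) ∧ (t ∈ H.connectedSets ∧ v ∈ t) := by
  constructor
  · intro h
    have huv : u ∈ s ∧ v ∈ t := by
      by_contra hn
      obtain ⟨x, hx⟩ := hs
      obtain ⟨y, hy⟩ := ht
      -- Without the new edge, no edge of the set changes the side.
      have := ((mem_connectedSets_iff.1 h).2 (.inl x) (.inr y) (by simpa) (by simpa))
        |>.map_of_eq_or_adj (H := (⊥ : SimpleGraph Bool)) (f := fun z => z.1.isLeft) (by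
          rintro ⟨a | a, ha⟩ ⟨b | b, hb⟩ <;> simp at ha hb ⊢
          · rintro rfl rfl
            exact hn ⟨ha, hb⟩
          · rintro rfl rfl
            exact hn ⟨hb, ha⟩)
      simp at this
    refine ⟨⟨?_, huv.1⟩, ⟨?_, huv.2⟩⟩
    · have := image_mem_connectedSets (H := G) h (Sum.elim id fun _ => u) (by
        rintro (a | a) - (b | b) - <;> simp +contextual)
      convert this using 1
      simp [Set.image_union, Set.image_image, ht.image_const, huv.1]
    · have := image_mem_connectedSets (H := H) h (Sum.elim (fun _ => v) id) (by
        rintro (a | a) - (b | b) - <;> simp +contextual)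
      convert this using 1
      simp [Set.image_union, Set.image_image, hs.image_const, huv.2]
  · rintro ⟨⟨h1, hu⟩, h2, hv⟩
    have h1' : ((joinByEdge G H u v).induce (Sum.inl '' s)).Connected :=
      inl_image_mem_connectedSets_iff.2 h1
    have h2' : ((joinByEdge G H u v).induce (Sum.inr '' t)).Connected :=
      inr_image_mem_connectedSets_iff.2 h2
    exact connected_induce_union (v := .inl u) (w := .inr v) h1'.preconnected h2'.preconnected
      (by simpa) (by simpa) (by simp)

theorem injective_image_inl_union_image_inr :
    Function.Injective fun p : Set V × Set W =>
      (Sum.inl '' p.1 ∪ Sum.inr '' p.2 : Set (V ⊕ W)) := by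
  rintro ⟨s, t⟩ ⟨s', t'⟩ h
  have h1 := congrArg (Sum.inl ⁻¹' ·) h
  have h2 := congrArg (Sum.inr ⁻¹' ·) h
  simp [Set.preimage_image_eq _ Sum.inl_injective,
    Set.preimage_image_eq _ Sum.inr_injective] at h1 h2
  rw [h1, h2]

theorem exists_eq_image_inl_union_image_inr (S : Set (V ⊕ W)) :
    ∃ (s : Set V) (t : Set W), S = Sum.inl '' s ∪ Sum.inr '' t :=
  ⟨Sum.inl ⁻¹' S, Sum.inr ⁻¹' S, (Set.image_preimage_inl_union_image_preimage_inr S).symm⟩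

/-- A connected set of a join that contains the end `v` of the new edge consists of a connected
set through `v` and, on the other side, of a connected set through `u` or of no vertices. -/
theorem ncard_connectedSets_joinByEdge_mem [Finite V] [Finite W] :
    {S | S ∈ (joinByEdge G H u v).connectedSets ∧ .inr v ∈ S}.ncard =
      (1 + {s | s ∈ G.connectedSets ∧ u ∈ s}.ncard) *
        {t | t ∈ H.connectedSets ∧ v ∈ t}.ncard := by
  have h : {S | S ∈ (joinByEdge G H u v).connectedSets ∧ .inr v ∈ S} =
      (fun p : Set V × Set W => (Sum.inl '' p.1 ∪ Sum.inr '' p.2 : Set (V ⊕ W))) ''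
        ((insert ∅ {s | s ∈ G.connectedSets ∧ u ∈ s}) ×ˢ
          {t | t ∈ H.connectedSets ∧ v ∈ t}) := by
    ext S
    obtain ⟨s, t, rfl⟩ := exists_eq_image_inl_union_image_inr S
    rw [injective_image_inl_union_image_inr.mem_set_image (a := (s, t))]
    simp only [Set.mem_ofPred_eq, Set.mem_prod, Set.mem_insert_iff, Set.mem_union, Set.mem_image,
      reduceCtorEq, and_false, exists_false, Sum.inr.injEq, exists_eq_right, false_or]
    rcases s.eq_empty_or_nonempty with rfl | hs
    · simp [inr_image_mem_connectedSets_iff]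
    · constructor
      · rintro ⟨hS, hv⟩
        have := (union_mem_connectedSets_iff hs ⟨v, hv⟩).1 hS
        exact ⟨Or.inr this.1, this.2⟩
      · rintro ⟨hs' | hs', ht⟩
        · exact absurd hs' hs.ne_empty
        · exact ⟨(union_mem_connectedSets_iff hs ⟨v, ht.2⟩).2 ⟨hs', ht⟩, ht.2⟩
  rw [h, Set.ncard_image_of_injective _ injective_image_inl_union_image_inr, Set.ncard_prod,
    Set.ncard_insert_of_notMem (by simp), add_comm]

/-- A connected set of a join that avoids the end `v` of the new edge lies on one of the two
sides. -/
theorem ncard_connectedSets_joinByEdge_notMem [Finite V] [Finite W] :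
    {S | S ∈ (joinByEdge G H u v).connectedSets ∧ .inr v ∉ S}.ncard =
      G.connectedSets.ncard + {t | t ∈ H.connectedSets ∧ v ∉ t}.ncard := by
  have h : {S | S ∈ (joinByEdge G H u v).connectedSets ∧ .inr v ∉ S} =
      (Sum.inl '' · : Set V → Set (V ⊕ W)) '' G.connectedSets ∪
        (Sum.inr '' · : Set W → Set (V ⊕ W)) '' {t | t ∈ H.connectedSets ∧ v ∉ t} := by
    ext S
    constructor
    · rintro ⟨hS, hv⟩
      obtain ⟨s, t, rfl⟩ := exists_eq_image_inl_union_image_inr S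
      rcases s.eq_empty_or_nonempty with rfl | hs
      · right
        simp only [Set.image_empty, Set.empty_union] at hS hv ⊢
        exact ⟨t, ⟨inr_image_mem_connectedSets_iff.1 hS, by simpa using hv⟩, rfl⟩
      rcases t.eq_empty_or_nonempty with rfl | ht
      · left
        simp only [Set.image_empty, Set.union_empty] at hS hv ⊢
        exact ⟨s, inl_image_mem_connectedSets_iff.1 hS, rfl⟩
      · have := (union_mem_connectedSets_iff hs ht).1 hS
        simp [this.2.2] at hv
    · rintro (⟨s, hs, rfl⟩ | ⟨t, ht, rfl⟩)
      · exact ⟨inl_image_mem_connectedSets_iff.2 hs, by simp⟩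
      · exact ⟨inr_image_mem_connectedSets_iff.2 ht.1, by simpa using ht.2⟩
  rw [h, Set.ncard_union_eq, Set.ncard_image_of_injective _ Sum.inl_injective.image_injective,
    Set.ncard_image_of_injective _ Sum.inr_injective.image_injective]
  rw [Set.disjoint_left]
  rintro _ ⟨s, hs, rfl⟩ ⟨t, ht, h⟩
  obtain ⟨x, hx⟩ := (mem_connectedSets_iff.1 hs).1
  have : (Sum.inl x : V ⊕ W) ∈ (Sum.inr '' t : Set (V ⊕ W)) := by
    simp only at h
    rw [h]
    exact ⟨x, hx, rfl⟩
  simp at this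

end joinByEdge

theorem Iso.ncard_connectedSets {G : SimpleGraph V} {H : SimpleGraph W} (e : G ≃g H)
    (p : Set V → Prop) (q : Set W → Prop) (hpq : ∀ s, p s ↔ q (e '' s)) :
    {s | s ∈ G.connectedSets ∧ p s}.ncard = {t | t ∈ H.connectedSets ∧ q t}.ncard := by
  rw [← Set.ncard_image_of_injective _ e.injective.image_injective]
  congr 1
  ext t
  constructor
  · rintro ⟨s, ⟨hs, hp⟩, rfl⟩
    exact ⟨image_mem_connectedSets hs _ fun x _ y _ h => Or.inr (e.map_adj_iff.2 h), (hpq s).1 hp⟩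
  · rintro ⟨ht, hq⟩
    have h : e '' (e.symm '' t) = t := by simp [Set.image_image]
    exact ⟨e.symm '' t, ⟨image_mem_connectedSets ht _ fun x _ y _ h =>
      Or.inr (e.symm.map_adj_iff.2 h), (hpq _).2 (by rwa [h])⟩, h⟩

end SimpleGraph

/-! ### The recursive structure of rooted ordered trees -/

namespace PlaneTree

/-- The tree with one vertex. -/
def leaf : PlaneTree := node 0 Fin.elim0

/-- The tree obtained from `b` by attaching `a` as a new first branch to the root. -/
def graft (a : PlaneTree) : PlaneTree → PlaneTree
  | node k branch => node (k + 1) (Fin.cons a branch)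

theorem node_zero (branch : Fin 0 → PlaneTree) : node 0 branch = leaf := by
  rw [leaf, Subsingleton.elim branch]

theorem node_succ {k : ℕ} (branch : Fin (k + 1) → PlaneTree) :
    node (k + 1) branch = graft (branch 0) (node k (Fin.tail branch)) := by
  rw [graft, Fin.cons_self_tail]

theorem graft_ne_leaf (a b : PlaneTree) : graft a b ≠ leaf := by
  cases b
  simp [graft, leaf]

theorem graft_injective : Function.Injective fun p : PlaneTree × PlaneTree => graft p.1 p.2 := by
  rintro ⟨a, k, br⟩ ⟨a', k', br'⟩ h
  simp only [graft, node.injEq, Nat.add_right_cancel_iff] at h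
  obtain ⟨rfl, h⟩ := h
  have := Fin.cons_injective2 (eq_of_heq h)
  simp [this.1, this.2]

theorem order_leaf : leaf.order = 1 := by simp [leaf, order_node]

theorem order_graft (a b : PlaneTree) : (graft a b).order = a.order + b.order := by
  cases b
  rw [graft, order_node, order_node, Fin.sum_univ_succ]
  simp only [Fin.cons_zero, Fin.cons_succ]
  omega

theorem order_pos (T : PlaneTree) : 0 < T.order := by
  cases T
  rw [order_node]
  omega

/-- Every tree arises from trees with one vertex by attaching first branches. -/
theorem induction_graft {P : PlaneTree → Prop} (h0 : P leaf)
    (h1 : ∀ a b, P a → P b → P (graft a b)) (T : PlaneTree) : P T := by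
  induction T with
  | node k branch ih =>
    induction k with
    | zero => rwa [node_zero]
    | succ k hk =>
      rw [node_succ]
      exact h1 _ _ (ih 0) (hk _ fun i => ih i.succ)

/-- A tree is either a single vertex, or it consists of its first branch and the rest. -/
noncomputable def equivOption : Option (PlaneTree × PlaneTree) ≃ PlaneTree :=
  Equiv.ofBijective (fun o => o.elim leaf fun p => graft p.1 p.2) <| by
    constructor
    · rintro (_ | p) (_ | q) h
      · rfl
      · exact absurd h.symm (graft_ne_leaf _ _)
      · exact absurd h (graft_ne_leaf _ _)
      · exact congrArg some (graft_injective h)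
    · rintro ⟨_ | k, branch⟩
      · exact ⟨none, (node_zero _).symm⟩
      · exact ⟨some (branch 0, node k (Fin.tail branch)), (node_succ _).symm⟩

@[simp] theorem equivOption_none : equivOption none = leaf := rfl

@[simp] theorem equivOption_some (p : PlaneTree × PlaneTree) :
    equivOption (some p) = graft p.1 p.2 := rfl

theorem isParent_inBranch_inBranch {k : ℕ} {branch : Fin k → PlaneTree} {i : Fin k}
    {u v : Vertex (branch i)} :
    IsParent (T := node k branch) (.inBranch i u) (.inBranch i v) ↔ IsParent u v := by
  constructor
  · intro h
    cases h with
    | inBranch _ h => exact h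
  · exact IsParent.inBranch i

theorem eq_of_isParent_inBranch {k : ℕ} {branch : Fin k → PlaneTree} {i j : Fin k}
    {u : Vertex (branch i)} {v : Vertex (branch j)}
    (h : IsParent (T := node k branch) (.inBranch i u) (.inBranch j v)) : i = j := by
  cases h with
  | inBranch _ _ => rfl

theorem isParent_root_inBranch {k : ℕ} {branch : Fin k → PlaneTree} {i : Fin k}
    {v : Vertex (branch i)} :
    IsParent (.root (node k branch)) (.inBranch i v) ↔ v = .root _ := by
  constructor
  · intro h
    cases h
    rfl
  · rintro rfl
    exact IsParent.root i

theorem not_isParent_root {T : PlaneTree} {v : Vertex T} : ¬ IsParent v (.root T) := by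
  intro h
  cases h

/-- The vertices of `graft a b` are those of `a` and those of `b`. -/
def graftVertex (a b : PlaneTree) : Vertex a ⊕ Vertex b → Vertex (graft a b) :=
  match b with
  | node _ branch => fun
    | .inl v => .inBranch (branch := Fin.cons a branch) 0 v
    | .inr (.root _) => .root _
    | .inr (.inBranch i v) => .inBranch (branch := Fin.cons a branch) i.succ v

theorem graftVertex_bijective (a b : PlaneTree) : Function.Bijective (graftVertex a b) := by
  obtain ⟨k, branch⟩ := b
  constructor
  · rintro (x | x) (y | y) h
    · cases h
      rfl
    · cases y <;> cases h
    · cases x <;> cases h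
    · cases x with
      | root =>
        cases y with
        | root => rfl
        | inBranch j y => cases h
      | inBranch i x =>
        cases y with
        | root => cases h
        | inBranch j y =>
          injection h with _ _ h1 h2
          obtain rfl := Fin.succ_injective _ h1
          rw [eq_of_heq h2]
  · intro v
    cases v with
    | root => exact ⟨.inr (.root _), rfl⟩
    | inBranch i v =>
      induction i using Fin.cases with
      | zero => exact ⟨.inl v, rfl⟩
      | succ i => exact ⟨.inr (.inBranch i v), rfl⟩

theorem graftVertex_root (a b : PlaneTree) :
    graftVertex a b (.inr (.root b)) = .root (graft a b) := by
  cases b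
  rfl

theorem isParent_graftVertex_inl_inl {a b : PlaneTree} {x y : Vertex a} :
    IsParent (graftVertex a b (.inl x)) (graftVertex a b (.inl y)) ↔ IsParent x y := by
  cases b
  exact isParent_inBranch_inBranch

theorem isParent_graftVertex_inr_inr {a b : PlaneTree} {x y : Vertex b} :
    IsParent (graftVertex a b (.inr x)) (graftVertex a b (.inr y)) ↔ IsParent x y := by
  cases b with
  | node k branch =>
    cases x with
    | root =>
      cases y with
      | root =>
        rw [graftVertex_root]
        simp only [not_isParent_root]
      | inBranch j w =>
        rw [isParent_root_inBranch]
        exact isParent_root_inBranch (branch := Fin.cons a branch) (i := j.succ)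
    | inBranch i v =>
      cases y with
      | root =>
        rw [graftVertex_root]
        simp only [not_isParent_root]
      | inBranch j w =>
        by_cases hij : i = j
        · subst hij
          rw [isParent_inBranch_inBranch]
          exact isParent_inBranch_inBranch (branch := Fin.cons a branch) (i := i.succ)
        · refine iff_of_false (fun h => hij ?_) (fun h => hij (eq_of_isParent_inBranch h))
          exact Fin.succ_injective _
            (eq_of_isParent_inBranch (branch := Fin.cons a branch) (i := i.succ) (j := j.succ) h)

theorem isParent_graftVertex_inr_inl {a b : PlaneTree} {x : Vertex b} {y : Vertex a} :
    IsParent (graftVertex a b (.inr x)) (graftVertex a b (.inl y)) ↔ x = .root b ∧ y = .root a := by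
  cases b with
  | node k branch =>
    cases x with
    | root =>
      simp only [true_and]
      exact isParent_root_inBranch (branch := Fin.cons a branch) (i := 0)
    | inBranch i v =>
      simp only [reduceCtorEq, false_and, iff_false]
      intro h
      exact Fin.succ_ne_zero _
        (eq_of_isParent_inBranch (branch := Fin.cons a branch) (i := i.succ) (j := 0) h)

theorem not_isParent_graftVertex_inl_inr {a b : PlaneTree} {x : Vertex a} {y : Vertex b} :
    ¬ IsParent (graftVertex a b (.inl x)) (graftVertex a b (.inr y)) := by
  cases b with
  | node k branch =>
    cases y with
    | root =>
      rw [graftVertex_root]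
      exact not_isParent_root
    | inBranch i v =>
      intro h
      exact (Fin.succ_ne_zero _).symm
        (eq_of_isParent_inBranch (branch := Fin.cons a branch) (i := 0) (j := i.succ) h)

/-- The graph of `graft a b` arises from those of `a` and `b` by joining the two roots. -/
noncomputable def graftIso (a b : PlaneTree) :
    a.graph.joinByEdge b.graph (.root a) (.root b) ≃g (graft a b).graph where
  toEquiv := Equiv.ofBijective _ (graftVertex_bijective a b)
  map_rel_iff' := by
    have hinj := (graftVertex_bijective a b).injective
    rintro (x | x) (y | y) <;>
      simp [graph, SimpleGraph.fromRel_adj, hinj.eq_iff, isParent_graftVertex_inl_inl,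
        isParent_graftVertex_inr_inr, isParent_graftVertex_inr_inl,
        not_isParent_graftVertex_inl_inr, and_comm]

theorem graftIso_root (a b : PlaneTree) : graftIso a b (.inr (.root b)) = .root (graft a b) :=
  graftVertex_root a b

theorem subsingleton_vertex_leaf : Subsingleton (Vertex leaf) := by
  constructor
  intro x y
  cases x with
  | root =>
    cases y with
    | root => rfl
    | inBranch i => exact i.elim0
  | inBranch i => exact i.elim0

theorem isAcyclic_graph (T : PlaneTree) : T.graph.IsAcyclic := by
  induction T using induction_graft with
  | h0 =>
    have := subsingleton_vertex_leaf
    exact SimpleGraph.IsAcyclic.of_subsingleton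
  | h1 a b ha hb => exact (graftIso a b).isAcyclic_iff.1 (ha.joinByEdge hb _ _)

theorem rho₁_eq_ncard (T : PlaneTree) :
    T.rho₁ = {s | s ∈ T.graph.connectedSets ∧ Vertex.root T ∈ s}.ncard :=
  T.isAcyclic_graph.card_subtrees fun s => Vertex.root T ∈ s

theorem rho₂_eq_ncard (T : PlaneTree) :
    T.rho₂ = {s | s ∈ T.graph.connectedSets ∧ Vertex.root T ∉ s}.ncard :=
  T.isAcyclic_graph.card_subtrees fun s => Vertex.root T ∉ s

theorem rho_eq_ncard (T : PlaneTree) : T.rho = T.graph.connectedSets.ncard := by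
  have := T.isAcyclic_graph.card_subtrees fun _ => True
  simpa [rho] using this

theorem rho_eq_add (T : PlaneTree) : T.rho = T.rho₁ + T.rho₂ := by
  have := finite_vertex T
  rw [rho₁_eq_ncard, rho₂_eq_ncard, rho_eq_ncard, ← Set.ncard_union_eq]
  · congr 1
    ext s
    simp only [Set.mem_union, Set.mem_ofPred_eq]
    tauto
  · rw [Set.disjoint_left]
    rintro s ⟨-, h1⟩ ⟨-, h2⟩
    exact h2 h1

theorem rho₁_leaf : leaf.rho₁ = 1 := by
  have := subsingleton_vertex_leaf
  rw [rho₁_eq_ncard, Set.ncard_eq_one]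
  refine ⟨Set.univ, ?_⟩
  ext s
  simp only [Set.mem_ofPred_eq, Set.mem_singleton_iff]
  constructor
  · rintro ⟨-, h⟩
    exact Set.eq_univ_of_forall fun x => Subsingleton.elim (Vertex.root leaf) x ▸ h
  · rintro rfl
    refine ⟨SimpleGraph.mem_connectedSets_iff.2
      ⟨⟨Vertex.root _, trivial⟩, fun x y _ _ => ?_⟩, trivial⟩
    obtain rfl := Subsingleton.elim x y
    exact SimpleGraph.Reachable.rfl

theorem rho₂_leaf : leaf.rho₂ = 0 := by
  have := subsingleton_vertex_leaf
  rw [rho₂_eq_ncard, Set.ncard_eq_zero]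
  ext s
  simp only [Set.mem_ofPred_eq, Set.mem_empty_iff_false, iff_false, not_and, not_not]
  intro h
  obtain ⟨x, hx⟩ := (SimpleGraph.mem_connectedSets_iff.1 h).1
  exact Subsingleton.elim x (Vertex.root leaf) ▸ hx

theorem rho₁_graft (a b : PlaneTree) : (graft a b).rho₁ = (1 + a.rho₁) * b.rho₁ := by
  have := finite_vertex a
  have := finite_vertex b
  rw [rho₁_eq_ncard, rho₁_eq_ncard, rho₁_eq_ncard,
    ← SimpleGraph.ncard_connectedSets_joinByEdge_mem]
  refine ((graftIso a b).ncard_connectedSets _ _ fun s => ?_).symm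
  rw [← graftIso_root, (graftIso a b).injective.mem_set_image]

theorem rho₂_graft (a b : PlaneTree) : (graft a b).rho₂ = a.rho + b.rho₂ := by
  have := finite_vertex a
  have := finite_vertex b
  rw [rho₂_eq_ncard, rho_eq_ncard, rho₂_eq_ncard,
    ← SimpleGraph.ncard_connectedSets_joinByEdge_notMem]
  refine ((graftIso a b).ncard_connectedSets _ _ fun s => ?_).symm
  rw [← graftIso_root, (graftIso a b).injective.mem_set_image]

end PlaneTree

/-! ### Convergence of the generating functions -/

namespace PlaneTree

/-- The term `X(T) z^|T|` of the generating function of the index `X`. -/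
noncomputable def term {R : Type*} [CommSemiring R] (X : PlaneTree → ℕ) (z : R)
    (T : PlaneTree) : R :=
  X T * z ^ T.order

section term

variable {R : Type*} [CommSemiring R] (z : R)

theorem term_leaf (X : PlaneTree → ℕ) : term X z leaf = X leaf * z := by
  simp [term, order_leaf]

theorem term_one_graft (a b : PlaneTree) :
    term 1 z (graft a b) = term 1 z a * term 1 z b := by
  simp [term, order_graft, pow_add]

theorem term_rho₁_graft (a b : PlaneTree) :
    term rho₁ z (graft a b) = (term 1 z a + term rho₁ z a) * term rho₁ z b := by
  simp only [term, order_graft, pow_add, rho₁_graft, Pi.one_apply]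
  push_cast
  ring

theorem term_rho₂_graft (a b : PlaneTree) :
    term rho₂ z (graft a b) =
      (term rho₁ z a + term rho₂ z a) * term 1 z b + term 1 z a * term rho₂ z b := by
  simp only [term, order_graft, pow_add, rho₂_graft, rho_eq_add, Pi.one_apply]
  push_cast
  ring

theorem term_rho₁₁_graft (a b : PlaneTree) :
    term (rho₁ * rho₁) z (graft a b) =
      (term 1 z a + 2 * term rho₁ z a + term (rho₁ * rho₁) z a) * term (rho₁ * rho₁) z b := by
  simp only [term, order_graft, pow_add, rho₁_graft, Pi.one_apply, Pi.mul_apply]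
  push_cast
  ring

theorem term_rho₁₂_graft (a b : PlaneTree) :
    term (rho₁ * rho₂) z (graft a b) =
      (term rho₁ z a + term rho₂ z a + term (rho₁ * rho₁) z a + term (rho₁ * rho₂) z a) *
        term rho₁ z b + (term 1 z a + term rho₁ z a) * term (rho₁ * rho₂) z b := by
  simp only [term, order_graft, pow_add, rho₁_graft, rho₂_graft, rho_eq_add, Pi.one_apply,
    Pi.mul_apply]
  push_cast
  ring

theorem term_rho₂₂_graft (a b : PlaneTree) :
    term (rho₂ * rho₂) z (graft a b) =
      (term (rho₁ * rho₁) z a + 2 * term (rho₁ * rho₂) z a + term (rho₂ * rho₂) z a) *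
        term 1 z b + 2 * (term rho₁ z a + term rho₂ z a) * term rho₂ z b +
        term 1 z a * term (rho₂ * rho₂) z b := by
  simp only [term, order_graft, pow_add, rho₂_graft, rho_eq_add, Pi.one_apply, Pi.mul_apply]
  push_cast
  ring

end term

theorem genTerm_eq (X Y : PlaneTree → ℕ) (z : ℂ) : genTerm X Y z = term (X * Y) z := by
  ext T
  simp [genTerm, term]

theorem term_nonneg (X : PlaneTree → ℕ) {r : ℝ} (hr : 0 ≤ r) (T : PlaneTree) :
    0 ≤ term X r T := by
  unfold term
  positivity

theorem norm_term (X : PlaneTree → ℕ) (z : ℂ) (T : PlaneTree) :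
    ‖term X z T‖ = term X ‖z‖ T := by
  simp [term]

theorem finite_setOf_order_le (N : ℕ) : {T : PlaneTree | T.order ≤ N}.Finite := by
  refine ((Set.finite_le_nat N).biUnion fun n _ => finite_setOf_order_eq n).subset fun T hT => ?_
  exact Set.mem_biUnion (x := T.order) hT rfl

/-- The finite set of the trees with at most `N` vertices. -/
noncomputable def treesLE (N : ℕ) : Finset PlaneTree := (finite_setOf_order_le N).toFinset

@[simp] theorem mem_treesLE {N : ℕ} {T : PlaneTree} : T ∈ treesLE N ↔ T.order ≤ N := by
  simp [treesLE]

/-- The two parts of a tree with at most `N + 1` vertices have at most `N` vertices each. -/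
theorem sum_treesLE_succ_le {f : PlaneTree → ℝ} (hf : ∀ T, 0 ≤ f T) (N : ℕ) :
    ∑ T ∈ treesLE (N + 1), f T ≤
      f leaf + ∑ a ∈ treesLE N, ∑ b ∈ treesLE N, f (graft a b) := by
  classical
  have hsub : treesLE (N + 1) ⊆
      insert leaf ((treesLE N ×ˢ treesLE N).image fun p => graft p.1 p.2) := by
    intro T hT
    rw [mem_treesLE] at hT
    obtain ⟨_ | ⟨a, b⟩, rfl⟩ := equivOption.surjective T
    · exact Finset.mem_insert_self _ _
    · refine Finset.mem_insert_of_mem (Finset.mem_image.2 ⟨(a, b), ?_, rfl⟩)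
      have ha := order_pos a
      have hb := order_pos b
      simp only [equivOption_some, order_graft] at hT
      simp only [Finset.mem_product, mem_treesLE]
      omega
  refine (Finset.sum_le_sum_of_subset_of_nonneg hsub fun T _ _ => hf T).trans ?_
  rw [Finset.sum_insert, Finset.sum_image graft_injective.injOn, Finset.sum_product]
  simp only [Finset.mem_image, not_exists, not_and]
  exact fun p _ => graft_ne_leaf _ _

/-- A nonnegative family on trees is summable as soon as the recursive description of trees
turns a bound for the sum over small trees into the same bound for larger trees. -/
theorem summable_and_tsum_le {f : PlaneTree → ℝ} (hf : ∀ T, 0 ≤ f T) {B : ℝ} (hB : 0 ≤ B)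
    (h : ∀ N, ∑ T ∈ treesLE N, f T ≤ B →
      f leaf + ∑ a ∈ treesLE N, ∑ b ∈ treesLE N, f (graft a b) ≤ B) :
    Summable f ∧ ∑' T, f T ≤ B := by
  have hN (N : ℕ) : ∑ T ∈ treesLE N, f T ≤ B := by
    induction N with
    | zero =>
      have : treesLE 0 = ∅ := by
        ext T
        have := order_pos T
        simp
        omega
      simpa [this]
    | succ N ih => exact (sum_treesLE_succ_le hf N).trans (h N ih)
  have hu (u : Finset PlaneTree) : ∑ T ∈ u, f T ≤ B := by
    refine (Finset.sum_le_sum_of_subset_of_nonneg (t := treesLE (u.sup order)) ?_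
      fun T _ _ => hf T).trans (hN _)
    intro T hT
    rw [mem_treesLE]
    exact Finset.le_sup (f := order) hT
  exact ⟨summable_of_sum_le hf hu, Real.tsum_le_of_sum_le hf hu⟩

section bounds

variable {r c r₁ r₂ q p s : ℝ}

/-- `Dominates X r B` says that the generating function of `X` converges at `r ≥ 0`, with a sum
of at most `B`. -/
def Dominates (X : PlaneTree → ℕ) (r B : ℝ) : Prop :=
  0 ≤ r ∧ Summable (term X r) ∧ ∑' T, term X r T ≤ B

theorem Dominates.sum_le {X : PlaneTree → ℕ} (h : Dominates X r c) (u : Finset PlaneTree) :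
    ∑ T ∈ u, term X r T ≤ c :=
  (h.2.1.sum_le_tsum u fun T _ => term_nonneg X h.1 T).trans h.2.2

theorem Dominates.nonneg {X : PlaneTree → ℕ} (h : Dominates X r c) : 0 ≤ c :=
  (tsum_nonneg (term_nonneg X h.1)).trans h.2.2

/-! A generating function is dominated by each nonnegative number that satisfies, as an
inequality `≤`, the equation that the recursion imposes on the generating function. -/

theorem dominates_one (hr : 0 ≤ r) (hc : 0 ≤ c) (h : r + c * c ≤ c) : Dominates 1 r c := by
  refine ⟨hr, summable_and_tsum_le (term_nonneg 1 hr) hc fun N hN => ?_⟩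
  have h0 := Finset.sum_nonneg fun T (_ : T ∈ treesLE N) => term_nonneg 1 hr T
  simp only [term_leaf, term_one_graft, ← Finset.mul_sum, ← Finset.sum_mul, Pi.one_apply]
  refine le_trans ?_ h
  push_cast
  gcongr
  simp

theorem dominates_rho₁ (hC : Dominates 1 r c) (hr₁ : 0 ≤ r₁) (h : r + (c + r₁) * r₁ ≤ r₁) :
    Dominates rho₁ r r₁ := by
  have hr := hC.1
  refine ⟨hr, summable_and_tsum_le (term_nonneg rho₁ hr) hr₁ fun N hN => ?_⟩
  have h0 := Finset.sum_nonneg fun T (_ : T ∈ treesLE N) => term_nonneg rho₁ hr T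
  have hc := hC.nonneg
  simp only [term_leaf, term_rho₁_graft, ← Finset.mul_sum, ← Finset.sum_mul, rho₁_leaf,
    Finset.sum_add_distrib]
  refine le_trans ?_ h
  push_cast
  rw [one_mul]
  gcongr
  exact hC.sum_le _

theorem dominates_rho₂ (hC : Dominates 1 r c) (hR : Dominates rho₁ r r₁) (hr₂ : 0 ≤ r₂)
    (h : (r₁ + r₂) * c + c * r₂ ≤ r₂) : Dominates rho₂ r r₂ := by
  have hr := hC.1
  refine ⟨hr, summable_and_tsum_le (term_nonneg rho₂ hr) hr₂ fun N hN => ?_⟩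
  have h0 := Finset.sum_nonneg fun T (_ : T ∈ treesLE N) => term_nonneg rho₂ hr T
  have h1 := Finset.sum_nonneg fun T (_ : T ∈ treesLE N) => term_nonneg 1 hr T
  have hc := hC.nonneg
  have hr₁ := hR.nonneg
  simp only [term_leaf, term_rho₂_graft, ← Finset.mul_sum, ← Finset.sum_mul, rho₂_leaf,
    Finset.sum_add_distrib]
  refine le_trans ?_ h
  push_cast
  rw [zero_mul, zero_add]
  gcongr
  exacts [hR.sum_le _, hC.sum_le _, hC.sum_le _]

theorem dominates_rho₁₁ (hC : Dominates 1 r c) (hR : Dominates rho₁ r r₁) (hq : 0 ≤ q)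
    (h : r + (c + 2 * r₁ + q) * q ≤ q) : Dominates (rho₁ * rho₁) r q := by
  have hr := hC.1
  refine ⟨hr, summable_and_tsum_le (term_nonneg _ hr) hq fun N hN => ?_⟩
  have h0 := Finset.sum_nonneg fun T (_ : T ∈ treesLE N) => term_nonneg (rho₁ * rho₁) hr T
  have hc := hC.nonneg
  have hr₁ := hR.nonneg
  simp only [term_leaf, term_rho₁₁_graft, ← Finset.mul_sum, ← Finset.sum_mul, rho₁_leaf,
    Finset.sum_add_distrib, Pi.mul_apply]
  refine le_trans ?_ h
  push_cast
  gcongr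
  exacts [(one_mul r).le, hC.sum_le _, hR.sum_le _]

theorem dominates_rho₁₂ (hC : Dominates 1 r c) (hR : Dominates rho₁ r r₁)
    (hR₂ : Dominates rho₂ r r₂) (hQ : Dominates (rho₁ * rho₁) r q) (hp : 0 ≤ p)
    (h : (r₁ + r₂ + q + p) * r₁ + (c + r₁) * p ≤ p) : Dominates (rho₁ * rho₂) r p := by
  have hr := hC.1
  refine ⟨hr, summable_and_tsum_le (term_nonneg _ hr) hp fun N hN => ?_⟩
  have h0 := Finset.sum_nonneg fun T (_ : T ∈ treesLE N) => term_nonneg (rho₁ * rho₂) hr T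
  have h1 := Finset.sum_nonneg fun T (_ : T ∈ treesLE N) => term_nonneg rho₁ hr T
  have hc := hC.nonneg
  have hr₁ := hR.nonneg
  have hr₂ := hR₂.nonneg
  have hq := hQ.nonneg
  simp only [term_leaf, term_rho₁₂_graft, ← Finset.mul_sum, ← Finset.sum_mul, rho₂_leaf,
    Finset.sum_add_distrib, Pi.mul_apply]
  refine le_trans ?_ h
  push_cast
  rw [mul_zero, zero_mul, zero_add]
  gcongr
  exacts [hR.sum_le _, hR₂.sum_le _, hQ.sum_le _, hR.sum_le _, hC.sum_le _, hR.sum_le _]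

theorem dominates_rho₂₂ (hC : Dominates 1 r c) (hR : Dominates rho₁ r r₁)
    (hR₂ : Dominates rho₂ r r₂) (hQ : Dominates (rho₁ * rho₁) r q)
    (hP : Dominates (rho₁ * rho₂) r p) (hs : 0 ≤ s)
    (h : (q + 2 * p + s) * c + 2 * (r₁ + r₂) * r₂ + c * s ≤ s) :
    Dominates (rho₂ * rho₂) r s := by
  have hr := hC.1
  refine ⟨hr, summable_and_tsum_le (term_nonneg _ hr) hs fun N hN => ?_⟩
  have h0 := Finset.sum_nonneg fun T (_ : T ∈ treesLE N) => term_nonneg (rho₂ * rho₂) hr T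
  have h1 := Finset.sum_nonneg fun T (_ : T ∈ treesLE N) => term_nonneg 1 hr T
  have h2 := Finset.sum_nonneg fun T (_ : T ∈ treesLE N) => term_nonneg rho₂ hr T
  have hc := hC.nonneg
  have hr₁ := hR.nonneg
  have hr₂ := hR₂.nonneg
  have hq := hQ.nonneg
  have hp := hP.nonneg
  simp only [term_leaf, term_rho₂₂_graft, ← Finset.mul_sum, ← Finset.sum_mul, rho₂_leaf,
    Finset.sum_add_distrib, Pi.mul_apply]
  refine le_trans ?_ h
  push_cast
  rw [zero_mul, zero_add]
  gcongr
  exacts [hQ.sum_le _, hP.sum_le _, hC.sum_le _, hR.sum_le _, hR₂.sum_le _, hR₂.sum_le _,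
    hC.sum_le _]

theorem Dominates.summable_norm {X : PlaneTree → ℕ} (h : Dominates X r c) {z : ℂ}
    (hz : ‖z‖ ≤ r) : Summable fun T => ‖term X z T‖ := by
  simp only [norm_term]
  refine Summable.of_nonneg_of_le (term_nonneg X (norm_nonneg z)) (fun T => ?_) h.2.1
  unfold term
  gcongr

end bounds

section values

/-! At `4/25`, where `√((1 - C)² - 4z)` vanishes, the bounds are the values of the generating
functions of `1`, `ρ₁` and `ρ₂`. -/

theorem dominates_one_at_four_div : Dominates 1 (4 / 25) (1 / 5) :=
  dominates_one (by norm_num) (by norm_num) (by norm_num)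

theorem dominates_rho₁_at_four_div : Dominates rho₁ (4 / 25) (2 / 5) :=
  dominates_rho₁ dominates_one_at_four_div (by norm_num) (by norm_num)

theorem dominates_rho₂_at_four_div : Dominates rho₂ (4 / 25) (2 / 15) :=
  dominates_rho₂ dominates_one_at_four_div dominates_rho₁_at_four_div (by norm_num) (by norm_num)

/-! At `8/81`, where `√((1 - C)² - 8z)` vanishes, the bounds are again the values of the
generating functions, up to that of `ρ₁²`. For `ρ₁ρ₂` and `ρ₂²` any bound suffices. -/

theorem dominates_one_at_eight_div : Dominates 1 (8 / 81) (1 / 9) :=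
  dominates_one (by norm_num) (by norm_num) (by norm_num)

theorem dominates_rho₁_at_eight_div : Dominates rho₁ (8 / 81) ((4 - 2 * √2) / 9) := by
  have h := Real.sq_sqrt (show (0 : ℝ) ≤ 2 by norm_num)
  have h2 : √2 ≤ 2 := Real.sqrt_le_iff.2 (by norm_num)
  exact dominates_rho₁ dominates_one_at_eight_div (by linarith) (by nlinarith)

theorem dominates_rho₂_at_eight_div : Dominates rho₂ (8 / 81) ((4 - 2 * √2) / 63) := by
  have h2 : √2 ≤ 2 := Real.sqrt_le_iff.2 (by norm_num)
  exact dominates_rho₂ dominates_one_at_eight_div dominates_rho₁_at_eight_div (by linarith)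
    (by linarith)

theorem dominates_rho₁₁_at_eight_div : Dominates (rho₁ * rho₁) (8 / 81) (2 * √2 / 9) := by
  have h := Real.sq_sqrt (show (0 : ℝ) ≤ 2 by norm_num)
  exact dominates_rho₁₁ dominates_one_at_eight_div dominates_rho₁_at_eight_div (by positivity)
    (by nlinarith)

theorem exists_dominates_rho₁₂_at_eight_div : ∃ p, Dominates (rho₁ * rho₂) (8 / 81) p := by
  have h := Real.sq_sqrt (show (0 : ℝ) ≤ 2 by norm_num)
  have h2 : √2 ≤ 2 := Real.sqrt_le_iff.2 (by norm_num)
  have h1 : 1 ≤ √2 := Real.le_sqrt_of_sq_le (by norm_num)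
  exact ⟨1, dominates_rho₁₂ dominates_one_at_eight_div dominates_rho₁_at_eight_div
    dominates_rho₂_at_eight_div dominates_rho₁₁_at_eight_div (by norm_num) (by nlinarith)⟩

theorem exists_dominates_rho₂₂_at_eight_div : ∃ s, Dominates (rho₂ * rho₂) (8 / 81) s := by
  obtain ⟨p, hp⟩ := exists_dominates_rho₁₂_at_eight_div
  have hp0 := hp.nonneg
  have h2 : √2 ≤ 2 := Real.sqrt_le_iff.2 (by norm_num)
  have h1 : 1 ≤ √2 := Real.le_sqrt_of_sq_le (by norm_num)
  exact ⟨1 + 2 * p, dominates_rho₂₂ dominates_one_at_eight_div dominates_rho₁_at_eight_div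
    dominates_rho₂_at_eight_div dominates_rho₁₁_at_eight_div hp (by positivity) (by nlinarith)⟩

end values

end PlaneTree

/-! ### Functional equations -/

namespace PlaneTree

/-- The generating function `∑_T X(T) z^|T|` of the index `X`. -/
noncomputable def gf (X : PlaneTree → ℕ) (z : ℂ) : ℂ := ∑' T, term X z T

theorem RR₁₁_eq_gf (z : ℂ) : RR₁₁ z = gf (rho₁ * rho₁) z := by rw [RR₁₁, genTerm_eq, gf]

theorem RR₁₂_eq_gf (z : ℂ) : RR₁₂ z = gf (rho₁ * rho₂) z := by rw [RR₁₂, genTerm_eq, gf]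

theorem RR₂₂_eq_gf (z : ℂ) : RR₂₂ z = gf (rho₂ * rho₂) z := by rw [RR₂₂, genTerm_eq, gf]

/-- The sum over all trees is the term of the one-vertex tree and a sum over pairs of trees. -/
theorem tsum_eq_leaf_add {f : PlaneTree → ℂ} {S : ℂ}
    (h : HasSum (fun p : PlaneTree × PlaneTree => f (graft p.1 p.2)) S) :
    ∑' T, f T = f leaf + S := by
  classical
  have h1 : HasSum (fun T => if T = leaf then 0 else f T) S := by
    rw [← graft_injective.hasSum_iff]
    · simpa [Function.comp_def, graft_ne_leaf] using h
    · intro T hT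
      obtain ⟨_ | p, rfl⟩ := equivOption.surjective T
      · simp
      · exact absurd ⟨p, rfl⟩ hT
  have h2 := (hasSum_ite_eq leaf (f leaf)).add h1
  rw [← h2.tsum_eq]
  congr 1
  ext T
  split_ifs with hT <;> simp [hT]

section equations

variable {X Y : PlaneTree → ℕ} {r : ℝ} {z : ℂ}

theorem hasSum_term (hX : Summable fun T => ‖term X z T‖) : HasSum (term X z) (gf X z) :=
  hX.of_norm.hasSum

theorem hasSum_term_mul_term (hX : Summable fun T => ‖term X z T‖)
    (hY : Summable fun T => ‖term Y z T‖) :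
    HasSum (fun p : PlaneTree × PlaneTree => term X z p.1 * term Y z p.2) (gf X z * gf Y z) :=
  (hasSum_term hX).mul (hasSum_term hY) (summable_mul_of_summable_norm hX hY)

variable {c r₁ r₂ q p s : ℝ}

theorem gf_one_eq (hC : Dominates 1 r c) (hz : ‖z‖ ≤ r) :
    gf 1 z = z + gf 1 z * gf 1 z := by
  have h := hC.summable_norm hz
  have := tsum_eq_leaf_add (f := term 1 z)
    (S := gf 1 z * gf 1 z) (by
    simp only [term_one_graft]
    exact hasSum_term_mul_term h h)
  simpa [gf, term_leaf] using this

theorem gf_rho₁_eq (hC : Dominates 1 r c) (hR : Dominates rho₁ r r₁) (hz : ‖z‖ ≤ r) :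
    gf rho₁ z = z + (gf 1 z + gf rho₁ z) * gf rho₁ z := by
  have h1 := hC.summable_norm hz
  have h2 := hR.summable_norm hz
  have := tsum_eq_leaf_add (f := term rho₁ z)
    (S := (gf 1 z + gf rho₁ z) * gf rho₁ z) (by
    simp only [term_rho₁_graft, add_mul]
    exact (hasSum_term_mul_term h1 h2).add (hasSum_term_mul_term h2 h2))
  simpa [gf, term_leaf, rho₁_leaf] using this

theorem gf_rho₂_eq (hC : Dominates 1 r c) (hR : Dominates rho₁ r r₁) (hR₂ : Dominates rho₂ r r₂)
    (hz : ‖z‖ ≤ r) :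
    gf rho₂ z = (gf rho₁ z + gf rho₂ z) * gf 1 z + gf 1 z * gf rho₂ z := by
  have h1 := hC.summable_norm hz
  have h2 := hR.summable_norm hz
  have h3 := hR₂.summable_norm hz
  have := tsum_eq_leaf_add (f := term rho₂ z)
    (S := (gf rho₁ z + gf rho₂ z) * gf 1 z + gf 1 z * gf rho₂ z) (by
    simp only [term_rho₂_graft, add_mul]
    exact ((hasSum_term_mul_term h2 h1).add (hasSum_term_mul_term h3 h1)).add
      (hasSum_term_mul_term h1 h3))
  simpa [gf, term_leaf, rho₂_leaf] using this

theorem gf_rho₁₁_eq (hC : Dominates 1 r c) (hR : Dominates rho₁ r r₁)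
    (hQ : Dominates (rho₁ * rho₁) r q) (hz : ‖z‖ ≤ r) :
    gf (rho₁ * rho₁) z =
      z + (gf 1 z + 2 * gf rho₁ z + gf (rho₁ * rho₁) z) * gf (rho₁ * rho₁) z := by
  have h1 := hC.summable_norm hz
  have h2 := hR.summable_norm hz
  have h4 := hQ.summable_norm hz
  have := tsum_eq_leaf_add (f := term (rho₁ * rho₁) z)
    (S := (gf 1 z + 2 * gf rho₁ z + gf (rho₁ * rho₁) z) * gf (rho₁ * rho₁) z) (by
    simp only [term_rho₁₁_graft, add_mul, mul_assoc]
    exact ((hasSum_term_mul_term h1 h4).add ((hasSum_term_mul_term h2 h4).mul_left 2)).add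
      (hasSum_term_mul_term h4 h4))
  simpa [gf, term_leaf, rho₁_leaf] using this

theorem gf_rho₁₂_eq (hC : Dominates 1 r c) (hR : Dominates rho₁ r r₁)
    (hR₂ : Dominates rho₂ r r₂) (hQ : Dominates (rho₁ * rho₁) r q)
    (hP : Dominates (rho₁ * rho₂) r p) (hz : ‖z‖ ≤ r) :
    gf (rho₁ * rho₂) z =
      (gf rho₁ z + gf rho₂ z + gf (rho₁ * rho₁) z + gf (rho₁ * rho₂) z) * gf rho₁ z +
        (gf 1 z + gf rho₁ z) * gf (rho₁ * rho₂) z := by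
  have h1 := hC.summable_norm hz
  have h2 := hR.summable_norm hz
  have h3 := hR₂.summable_norm hz
  have h4 := hQ.summable_norm hz
  have h5 := hP.summable_norm hz
  have := tsum_eq_leaf_add (f := term (rho₁ * rho₂) z)
    (S := (gf rho₁ z + gf rho₂ z + gf (rho₁ * rho₁) z + gf (rho₁ * rho₂) z) * gf rho₁ z +
        (gf 1 z + gf rho₁ z) * gf (rho₁ * rho₂) z) (by
    simp only [term_rho₁₂_graft, add_mul]
    exact ((((hasSum_term_mul_term h2 h2).add (hasSum_term_mul_term h3 h2)).add
      (hasSum_term_mul_term h4 h2)).add (hasSum_term_mul_term h5 h2)).add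
      ((hasSum_term_mul_term h1 h5).add (hasSum_term_mul_term h2 h5)))
  simpa [gf, term_leaf, rho₂_leaf] using this

theorem gf_rho₂₂_eq (hC : Dominates 1 r c) (hR : Dominates rho₁ r r₁)
    (hR₂ : Dominates rho₂ r r₂) (hQ : Dominates (rho₁ * rho₁) r q)
    (hP : Dominates (rho₁ * rho₂) r p) (hS : Dominates (rho₂ * rho₂) r s) (hz : ‖z‖ ≤ r) :
    gf (rho₂ * rho₂) z =
      (gf (rho₁ * rho₁) z + 2 * gf (rho₁ * rho₂) z + gf (rho₂ * rho₂) z) * gf 1 z +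
        2 * (gf rho₁ z + gf rho₂ z) * gf rho₂ z + gf 1 z * gf (rho₂ * rho₂) z := by
  have h1 := hC.summable_norm hz
  have h2 := hR.summable_norm hz
  have h3 := hR₂.summable_norm hz
  have h4 := hQ.summable_norm hz
  have h5 := hP.summable_norm hz
  have h6 := hS.summable_norm hz
  have := tsum_eq_leaf_add (f := term (rho₂ * rho₂) z)
    (S := (gf (rho₁ * rho₁) z + 2 * gf (rho₁ * rho₂) z + gf (rho₂ * rho₂) z) * gf 1 z +
        2 * (gf rho₁ z + gf rho₂ z) * gf rho₂ z + gf 1 z * gf (rho₂ * rho₂) z) (by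
    simp only [term_rho₂₂_graft, add_mul, mul_assoc, mul_add]
    exact ((((hasSum_term_mul_term h4 h1).add ((hasSum_term_mul_term h5 h1).mul_left 2)).add
      (hasSum_term_mul_term h6 h1)).add (((hasSum_term_mul_term h2 h3).mul_left 2).add
      ((hasSum_term_mul_term h3 h3).mul_left 2))).add (hasSum_term_mul_term h1 h6))
  simpa [gf, term_leaf, rho₂_leaf] using this

theorem norm_gf_le (hX : Dominates X r c) (hz : ‖z‖ ≤ r) : ‖gf X z‖ ≤ c := by
  refine (norm_tsum_le_tsum_norm (hX.summable_norm hz)).trans (le_trans ?_ hX.2.2)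
  refine (hX.summable_norm hz).tsum_le_tsum (fun T => ?_) hX.2.1
  rw [norm_term]
  unfold term
  gcongr

theorem differentiableOn_gf (hX : Dominates X r c) :
    DifferentiableOn ℂ (gf X) (Metric.ball 0 r) := by
  refine Complex.differentiableOn_tsum_of_summable_norm hX.2.1 (fun T => ?_)
    Metric.isOpen_ball fun T w hw => ?_
  · unfold term
    fun_prop
  · rw [norm_term]
    have : ‖w‖ ≤ r := by simpa using (Metric.mem_ball.1 hw).le
    unfold term
    gcongr

end equations
end PlaneTree

/-! ### Functions with a square-root singularity -/

theorem sq_cpow_half (x : ℂ) : (x ^ (1 / 2 : ℂ)) ^ 2 = x := by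
  rw [one_div]
  exact_mod_cast Complex.cpow_nat_inv_pow x (n := 2) two_ne_zero

theorem cpow_half_sq {x : ℂ} (hx : 0 < x.re) : (x ^ 2) ^ (1 / 2 : ℂ) = x := by
  rw [one_div]
  exact Complex.sq_cpow_two_inv hx

/-- The square root of a number of positive real part lies in the sector `|arg| < π / 4`. -/
theorem abs_im_lt_re_cpow_half {x : ℂ} (hx : 0 < x.re) :
    |(x ^ (1 / 2 : ℂ)).im| < (x ^ (1 / 2 : ℂ)).re := by
  have hx0 : x ≠ 0 := by
    rintro rfl
    simp at hx
  have hre : 0 < (x ^ (1 / 2 : ℂ)).re := by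
    rw [Complex.cpow_def_of_ne_zero hx0, Complex.exp_re]
    have him : (Complex.log x * (1 / 2)).im = x.arg / 2 := by
      rw [show Complex.log x * (1 / 2) = ((1 / 2 : ℝ) : ℂ) * Complex.log x by push_cast; ring,
        Complex.im_ofReal_mul, Complex.log_im]
      ring
    rw [him]
    have h := abs_lt.1 (Complex.abs_arg_lt_pi_div_two_iff.2 (Or.inl hx))
    refine mul_pos (Real.exp_pos _) (Real.cos_pos_of_mem_Ioo ⟨?_, ?_⟩) <;>
      linarith [Real.pi_pos, h.1, h.2]
  have h := congrArg Complex.re (sq_cpow_half x)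
  rw [sq, Complex.mul_re] at h
  refine abs_lt_of_sq_lt_sq ?_ hre.le
  nlinarith

/-- The product of two such square roots lies in the right half-plane, so it is the principal
square root of its square. -/
theorem re_mul_cpow_half_pos {x y : ℂ} (hx : 0 < x.re) (hy : 0 < y.re) :
    0 < (x ^ (1 / 2 : ℂ) * y ^ (1 / 2 : ℂ)).re := by
  have h1 := abs_lt.1 (abs_im_lt_re_cpow_half hx)
  have h2 := abs_lt.1 (abs_im_lt_re_cpow_half hy)
  rw [Complex.mul_re]
  nlinarith

theorem re_one_sub_div_pos {z z₀ : ℂ} (hz : ‖z‖ < ‖z₀‖) : 0 < (1 - z / z₀).re := by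
  have h0 : 0 < ‖z₀‖ := (norm_nonneg z).trans_lt hz
  have h1 : ‖z / z₀‖ < 1 := by rwa [norm_div, div_lt_one h0]
  have := (Complex.re_le_norm (z / z₀)).trans_lt h1
  simp only [Complex.sub_re, Complex.one_re]
  linarith

/-- On the circle `|w| = |z₀|`, the principal branch of `√(1 - w/z₀)` is analytic except at
`z₀`. -/
theorem one_sub_div_mem_slitPlane {w z₀ : ℂ} (h0 : z₀ ≠ 0) (hw : ‖w‖ = ‖z₀‖) (hne : w ≠ z₀) :
    1 - w / z₀ ∈ Complex.slitPlane := by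
  have h1 : ‖w / z₀‖ = 1 := by rw [norm_div, hw, div_self (norm_ne_zero_iff.2 h0)]
  left
  simp only [Complex.sub_re, Complex.one_re, sub_pos]
  refine lt_of_le_of_ne (h1 ▸ Complex.re_le_norm _) fun h => hne ?_
  have h2 : w / z₀ = 1 := by
    have h3 := Complex.re_eq_norm.1 (h.trans h1.symm)
    rw [Complex.le_def] at h3
    exact Complex.ext (by simpa using h) (by simpa using h3.2.symm)
  rwa [div_eq_one_iff_eq h0] at h2

/-- On the disc `|z| < |z₀|`, the function `f` equals `E(z) + F(z) √(1 - z/z₀)` for functions `E`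
and `F` that are analytic in the larger disc `|z| < r`. -/
structure HasSqrtForm (f : ℂ → ℂ) (z₀ : ℂ) (r : ℝ) (E F : ℂ → ℂ) : Prop where
  ne_zero : z₀ ≠ 0
  norm_lt : ‖z₀‖ < r
  diff_left : DifferentiableOn ℂ E (Metric.ball 0 r)
  diff_right : DifferentiableOn ℂ F (Metric.ball 0 r)
  eq : ∀ z, ‖z‖ < ‖z₀‖ → f z = E z + F z * (1 - z / z₀) ^ (1 / 2 : ℂ)

namespace HasSqrtForm

variable {f : ℂ → ℂ} {z₀ : ℂ} {r : ℝ} {E F : ℂ → ℂ}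

theorem analyticAt_left (h : HasSqrtForm f z₀ r E F) {z : ℂ} (hz : ‖z‖ ≤ ‖z₀‖) :
    AnalyticAt ℂ E z :=
  h.diff_left.analyticAt (Metric.isOpen_ball.mem_nhds (by simpa using hz.trans_lt h.norm_lt))

theorem analyticAt_right (h : HasSqrtForm f z₀ r E F) {z : ℂ} (hz : ‖z‖ ≤ ‖z₀‖) :
    AnalyticAt ℂ F z :=
  h.diff_right.analyticAt (Metric.isOpen_ball.mem_nhds (by simpa using hz.trans_lt h.norm_lt))

theorem analyticAt_form (h : HasSqrtForm f z₀ r E F) {z : ℂ} (hz : ‖z‖ ≤ ‖z₀‖)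
    (hs : 1 - z / z₀ ∈ Complex.slitPlane) :
    AnalyticAt ℂ (fun z => E z + F z * (1 - z / z₀) ^ (1 / 2 : ℂ)) z := by
  refine (h.analyticAt_left hz).add ((h.analyticAt_right hz).mul ?_)
  refine AnalyticAt.cpow ?_ analyticAt_const hs
  exact analyticAt_const.sub (analyticAt_id.div_const)

theorem eventually_eq (h : HasSqrtForm f z₀ r E F) (w : ℂ) :
    ∀ᶠ z in 𝓝[Metric.ball 0 ‖z₀‖] w, f z = E z + F z * (1 - z / z₀) ^ (1 / 2 : ℂ) := by
  filter_upwards [self_mem_nhdsWithin] with z hz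
  exact h.eq z (by simpa using hz)

/-- If `f` extended analytically to `z₀`, then so would `√(1 - z/z₀)`. But the square of an
analytic function has no simple zero. -/
theorem not_extendsAnalyticallyAt (h : HasSqrtForm f z₀ r E F) (hF : F z₀ ≠ 0) :
    ¬ ExtendsAnalyticallyAt f z₀ := by
  rintro ⟨g, hg, hfg⟩
  have hFa := h.analyticAt_right le_rfl
  set k : ℂ → ℂ := fun z => (g z - E z) / F z with hk
  have hka : AnalyticAt ℂ k z₀ := (hg.sub (h.analyticAt_left le_rfl)).div hFa hF
  have hsq : ∀ᶠ z in 𝓝[Metric.ball 0 ‖z₀‖] z₀, k z ^ 2 = 1 - z / z₀ := by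
    filter_upwards [hfg, h.eventually_eq z₀,
      nhdsWithin_le_nhds (hFa.continuousAt.eventually_ne hF)] with z h1 h2 h3
    have : k z = (1 - z / z₀) ^ (1 / 2 : ℂ) := by
      simp only [hk]
      rw [div_eq_iff h3, ← h1, h2]
      ring
    rw [this, sq_cpow_half]
  have hl : AnalyticAt ℂ (fun z => 1 - z / z₀) z₀ := analyticAt_const.sub analyticAt_id.div_const
  have hmem : z₀ ∈ closure (Metric.ball (0 : ℂ) ‖z₀‖) := by
    rw [closure_ball _ (norm_ne_zero_iff.2 h.ne_zero)]
    simp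
  have hle : 𝓝[Metric.ball 0 ‖z₀‖] z₀ ≤ 𝓝[≠] z₀ := by
    refine nhdsWithin_mono _ fun z hz => ?_
    rintro rfl
    simp at hz
  have hne : (𝓝[Metric.ball 0 ‖z₀‖] z₀).NeBot := mem_closure_iff_nhdsWithin_neBot.1 hmem
  have heq : ∀ᶠ z in 𝓝 z₀, k z ^ 2 = 1 - z / z₀ :=
    ((hka.pow 2).frequently_eq_iff_eventually_eq hl).1 (hsq.frequently.filter_mono hle)
  have hd1 : HasDerivAt (fun z => k z ^ 2) (2 * k z₀ ^ (2 - 1) * deriv k z₀) z₀ := by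
    simpa using hka.differentiableAt.hasDerivAt.fun_pow 2
  have hd2 : HasDerivAt (fun z => 1 - z / z₀) (-(1 / z₀)) z₀ := by
    simpa using ((hasDerivAt_id z₀).div_const z₀).const_sub 1
  have hk0 : k z₀ = 0 := by
    have := heq.self_of_nhds
    rw [div_self h.ne_zero, sub_self] at this
    exact pow_eq_zero_iff two_ne_zero |>.1 this
  have := hd1.unique (hd2.congr_of_eventuallyEq heq)
  rw [hk0] at this
  simp [h.ne_zero] at this

theorem isSmallestSingularity (h : HasSqrtForm f z₀ r E F) (hF : F z₀ ≠ 0) :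
    IsSmallestSingularity f z₀ where
  analytic := by
    intro z hz
    have hz' : ‖z‖ < ‖z₀‖ := by simpa using hz
    refine (h.analyticAt_form hz'.le (Or.inl (re_one_sub_div_pos hz'))).congr ?_
    filter_upwards [Metric.isOpen_ball.mem_nhds hz] with w hw
    exact (h.eq w (by simpa using hw)).symm
  singular := h.not_extendsAnalyticallyAt hF
  regular w hw hne :=
    ⟨_, h.analyticAt_form hw.le (one_sub_div_mem_slitPlane h.ne_zero hw hne), by
      rw [hw]
      exact h.eventually_eq w⟩

theorem hasSqrtExpansion (h : HasSqrtForm f z₀ r E F) :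
    HasSqrtExpansion f z₀ (E z₀) (F z₀) := by
  -- With `t = √(1 - z/z₀)`, one has `z = z₀ (1 - t²)`.
  have hp : HasDerivAt (fun t : ℂ => z₀ * (1 - t ^ 2)) 0 0 := by
    simpa using (((hasDerivAt_id (0 : ℂ)).pow 2).const_sub 1).const_mul z₀
  have hpa : AnalyticAt ℂ (fun t : ℂ => z₀ * (1 - t ^ 2)) 0 := by fun_prop
  have hE : AnalyticAt ℂ E (z₀ * (1 - 0 ^ 2)) := by simpa using h.analyticAt_left le_rfl
  have hF : AnalyticAt ℂ F (z₀ * (1 - 0 ^ 2)) := by simpa using h.analyticAt_right le_rfl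
  refine ⟨fun t => E (z₀ * (1 - t ^ 2)) + F (z₀ * (1 - t ^ 2)) * t,
    (hE.comp_of_eq hpa rfl).add ((hF.comp_of_eq hpa rfl).mul analyticAt_id), by simp, ?_, ?_⟩
  · have h1 := hE.differentiableAt.hasDerivAt.comp (0 : ℂ) hp
    have h2 := (hF.differentiableAt.hasDerivAt.comp (0 : ℂ) hp).fun_mul (hasDerivAt_id 0)
    have := (h1.fun_add h2).deriv
    simpa [Function.comp_def] using this
  · filter_upwards [h.eventually_eq z₀] with z hz
    rw [hz, sq_cpow_half]
    have : z₀ * (1 - (1 - z / z₀)) = z := by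
      have := h.ne_zero
      field_simp
      ring
    rw [this]

end HasSqrtForm

/-! ### Closed forms of the generating functions -/

namespace PlaneTree

/-- The square root `√((1 - C)² - 4z)` of the discriminant of the equation for the generating
function of `ρ₁`, where `C` is the generating function of all trees. -/
noncomputable def discRoot (z : ℂ) : ℂ := 1 - gf 1 z - 2 * gf rho₁ z

/-- The square of `sqrtFactor`, which has positive real part in the disc `|z| < 4/25`. -/
noncomputable def sqrtFactorSq (z : ℂ) : ℂ := 8 * (1 - gf 1 z) / (8 - 9 * gf 1 z)

/-- The coefficient of `√(1 - z/z₀)` in `√((1 - C)² - 8z)`. -/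
noncomputable def sqrtFactor (z : ℂ) : ℂ := sqrtFactorSq z ^ (1 / 2 : ℂ)

section large_disc

variable {z : ℂ}

theorem norm_gf_one_le (hz : ‖z‖ ≤ 4 / 25) : ‖gf 1 z‖ ≤ 1 / 5 :=
  norm_gf_le dominates_one_at_four_div hz

theorem gf_one_eq' (hz : ‖z‖ ≤ 4 / 25) : z = gf 1 z - gf 1 z * gf 1 z := by
  linear_combination -gf_one_eq dominates_one_at_four_div hz

/-- Since `|C| ≤ 1/5` in the disc `|z| ≤ 4/25`, the denominators `1 - 2C` and `8 - 9C` below do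
not vanish. -/
theorem gf_one_ne {x : ℂ} (hz : ‖z‖ ≤ 4 / 25) (hx : 1 / 5 < ‖x‖) : gf 1 z ≠ x := by
  rintro rfl
  exact absurd (norm_gf_one_le hz) (not_le.2 hx)

theorem one_sub_gf_ne_zero (hz : ‖z‖ ≤ 4 / 25) : 1 - gf 1 z ≠ 0 :=
  sub_ne_zero.2 (gf_one_ne hz (by norm_num)).symm

theorem one_sub_two_mul_gf_ne_zero (hz : ‖z‖ ≤ 4 / 25) : 1 - 2 * gf 1 z ≠ 0 := by
  intro h
  refine gf_one_ne (x := 1 / 2) hz (by norm_num) ?_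
  linear_combination -(1 / 2 : ℂ) * h

theorem eight_sub_nine_mul_gf_ne_zero (hz : ‖z‖ ≤ 4 / 25) : 8 - 9 * gf 1 z ≠ 0 := by
  intro h
  refine gf_one_ne (x := 8 / 9) hz (by norm_num) ?_
  linear_combination -(1 / 9 : ℂ) * h

theorem discRoot_sq (hz : ‖z‖ ≤ 4 / 25) :
    discRoot z ^ 2 = (1 - gf 1 z) * (1 - 5 * gf 1 z) := by
  have h1 := gf_one_eq dominates_one_at_four_div hz
  have h2 := gf_rho₁_eq dominates_one_at_four_div dominates_rho₁_at_four_div hz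
  unfold discRoot
  linear_combination -4 * h2 + 4 * h1

/-- A zero of `(1 - C)(1 - 5C)` has `C = 1/5`, that is, `z = C - C² = 4/25`. -/
theorem discRoot_ne_zero (hz : ‖z‖ < 4 / 25) : discRoot z ≠ 0 := by
  intro h
  have h1 := discRoot_sq hz.le
  rw [h, zero_pow two_ne_zero, eq_comm, mul_eq_zero,
    or_iff_right (one_sub_gf_ne_zero hz.le)] at h1
  have h2 : gf 1 z = 1 / 5 := by linear_combination -(1 / 5 : ℂ) * h1
  have h3 := gf_one_eq' hz.le
  rw [h2] at h3
  rw [h3] at hz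
  norm_num at hz

theorem gf_rho₂_eq' (hz : ‖z‖ ≤ 4 / 25) :
    gf rho₂ z * (1 - 2 * gf 1 z) = gf 1 z * gf rho₁ z := by
  linear_combination gf_rho₂_eq dominates_one_at_four_div dominates_rho₁_at_four_div
    dominates_rho₂_at_four_div hz

theorem sqrtFactorSq_re_pos (hz : ‖z‖ ≤ 4 / 25) : 0 < (sqrtFactorSq z).re := by
  have h := norm_gf_one_le hz
  have h1 := (Complex.re_le_norm (gf 1 z)).trans h
  have h0 := Complex.normSq_pos.2 (eight_sub_nine_mul_gf_ne_zero hz)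
  rw [sqrtFactorSq, Complex.div_re, ← add_div]
  refine div_pos ?_ h0
  -- It remains to bound the real part of `8 (1 - C)` times the conjugate of `8 - 9C`.
  simp
  nlinarith [sq_nonneg (gf 1 z).im, sq_nonneg (gf 1 z).re]

theorem differentiableOn_gf_one : DifferentiableOn ℂ (gf 1) (Metric.ball 0 (4 / 25)) :=
  differentiableOn_gf dominates_one_at_four_div

theorem differentiableOn_gf_rho₁ : DifferentiableOn ℂ (gf rho₁) (Metric.ball 0 (4 / 25)) :=
  differentiableOn_gf dominates_rho₁_at_four_div

theorem differentiableOn_gf_rho₂ : DifferentiableOn ℂ (gf rho₂) (Metric.ball 0 (4 / 25)) :=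
  differentiableOn_gf dominates_rho₂_at_four_div

theorem norm_le_of_mem_ball {r : ℝ} (hz : z ∈ Metric.ball (0 : ℂ) r) : ‖z‖ ≤ r := by
  simpa using (Metric.mem_ball.1 hz).le

theorem differentiableOn_discRoot :
    DifferentiableOn ℂ discRoot (Metric.ball 0 (4 / 25)) :=
  ((differentiableOn_const 1).sub differentiableOn_gf_one).sub
    (differentiableOn_gf_rho₁.const_mul 2)

theorem differentiableOn_sqrtFactor :
    DifferentiableOn ℂ sqrtFactor (Metric.ball 0 (4 / 25)) := by
  have h := differentiableOn_gf_one
  refine DifferentiableOn.cpow_const (c := 1 / 2) (f := sqrtFactorSq) ?_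
    fun z hz => Or.inl (sqrtFactorSq_re_pos (norm_le_of_mem_ball hz))
  refine DifferentiableOn.div (by fun_prop) (by fun_prop) fun z hz => ?_
  exact eight_sub_nine_mul_gf_ne_zero (norm_le_of_mem_ball hz)

end large_disc

section small_disc

variable {z : ℂ}

/-- The closed form of `RR₁₁`: one of the two roots of its quadratic equation. -/
theorem gf_rho₁₁_eq' (hz : ‖z‖ < 8 / 81) :
    gf (rho₁ * rho₁) z =
      discRoot z / 2 + -(1 / 2) * sqrtFactor z * (1 - z / (8 / 81)) ^ (1 / 2 : ℂ) := by
  have hz' : ‖z‖ ≤ 4 / 25 := by linarith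
  have hC := gf_one_eq' hz'
  have hD := discRoot_sq hz'
  have hQ := gf_rho₁₁_eq dominates_one_at_eight_div dominates_rho₁_at_eight_div
    dominates_rho₁₁_at_eight_div hz.le
  set q := gf (rho₁ * rho₁) z with hq
  set w := sqrtFactor z * (1 - z / (8 / 81)) ^ (1 / 2 : ℂ) with hw
  have hw2 : w ^ 2 = (1 - gf 1 z) * (1 - 9 * gf 1 z) := by
    rw [hw, mul_pow, sq_cpow_half, sqrtFactor, sq_cpow_half, sqrtFactorSq]
    have := eight_sub_nine_mul_gf_ne_zero hz'
    rw [div_mul_eq_mul_div, div_eq_iff this]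
    linear_combination (-81 * (1 - gf 1 z)) * hC
  have hv2 : (discRoot z - 2 * q) ^ 2 = w ^ 2 := by
    rw [hw2]
    have : discRoot z = 1 - gf 1 z - 2 * gf rho₁ z := rfl
    linear_combination hD - 4 * hQ - 4 * hC - 4 * q * this
  have hwpos : 0 < w.re :=
    re_mul_cpow_half_pos (sqrtFactorSq_re_pos hz') (re_one_sub_div_pos (by
      rw [show ‖(8 / 81 : ℂ)‖ = 8 / 81 by norm_num]
      exact hz))
  -- `C + 2 R + RR₁₁` is bounded by its value at `8/81`, so this root has nonnegative real part.
  have hvnonneg : 0 ≤ (discRoot z - 2 * q).re := by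
    have h1 := (Complex.re_le_norm _).trans (norm_gf_le dominates_one_at_eight_div hz.le)
    have h2 := (Complex.re_le_norm _).trans (norm_gf_le dominates_rho₁_at_eight_div hz.le)
    have h3 := (Complex.re_le_norm _).trans (norm_gf_le dominates_rho₁₁_at_eight_div hz.le)
    rw [← hq] at h3
    simp only [discRoot, Complex.sub_re, Complex.one_re, Complex.mul_re, Complex.re_ofNat,
      Complex.im_ofNat, zero_mul, sub_zero]
    linarith
  rcases sq_eq_sq_iff_eq_or_eq_neg.1 hv2 with h | h
  · rw [mul_assoc, ← hw]
    linear_combination -(1 / 2 : ℂ) * h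
  · rw [h, Complex.neg_re] at hvnonneg
    linarith

/-- The equations for `RR₁₂` and `RR₂₂` are linear, so that `RR` is an affine function of `RR₁₁`
with coefficients that are analytic in the disc `|z| < 4/25`. -/
theorem RR_eq (hz : ‖z‖ < 8 / 81) :
    RR z = (1 - gf 1 z) ^ 2 / ((1 - 2 * gf 1 z) * discRoot z) * gf (rho₁ * rho₁) z +
      ((1 - gf 1 z) * (2 * gf rho₁ z * (gf rho₁ z + gf rho₂ z)) / discRoot z +
        2 * (gf rho₁ z + gf rho₂ z) * gf rho₂ z) / (1 - 2 * gf 1 z) := by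
  have hz' : ‖z‖ < 4 / 25 := by linarith
  have h1 := one_sub_two_mul_gf_ne_zero hz'.le
  have h2 := discRoot_ne_zero hz'
  obtain ⟨p, hP⟩ := exists_dominates_rho₁₂_at_eight_div
  obtain ⟨s, hS⟩ := exists_dominates_rho₂₂_at_eight_div
  have e1 := gf_rho₁₂_eq dominates_one_at_eight_div dominates_rho₁_at_eight_div
    dominates_rho₂_at_eight_div dominates_rho₁₁_at_eight_div hP hz.le
  have e2 := gf_rho₂₂_eq dominates_one_at_eight_div dominates_rho₁_at_eight_div
    dominates_rho₂_at_eight_div dominates_rho₁₁_at_eight_div hP hS hz.le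
  have e3 : gf (rho₁ * rho₂) z =
      gf rho₁ z * (gf rho₁ z + gf rho₂ z + gf (rho₁ * rho₁) z) / discRoot z := by
    rw [eq_div_iff h2, discRoot]
    linear_combination e1
  rw [RR, RR₁₁_eq_gf, RR₁₂_eq_gf, RR₂₂_eq_gf]
  have e4 : gf (rho₂ * rho₂) z =
      ((gf (rho₁ * rho₁) z + 2 * gf (rho₁ * rho₂) z) * gf 1 z +
        2 * (gf rho₁ z + gf rho₂ z) * gf rho₂ z) / (1 - 2 * gf 1 z) := by
    rw [eq_div_iff h1]
    linear_combination e2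
  rw [e4, e3]
  have h3 : discRoot z = 1 - gf 1 z - 2 * gf rho₁ z := rfl
  field_simp
  rw [h3]
  ring

end small_disc

theorem hasSqrtForm_RR₁₁ :
    HasSqrtForm RR₁₁ (8 / 81) (4 / 25) (fun z => discRoot z / 2)
      (fun z => -(1 / 2) * sqrtFactor z) where
  ne_zero := by norm_num
  norm_lt := by norm_num
  diff_left := differentiableOn_discRoot.div_const 2
  diff_right := differentiableOn_sqrtFactor.const_mul _
  eq z hz := by
    rw [RR₁₁_eq_gf]
    exact gf_rho₁₁_eq' (by simpa using hz)

/-- The factor of `RR₁₁` in the formula for `RR`. -/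
noncomputable def leadFactor (z : ℂ) : ℂ :=
  (1 - gf 1 z) ^ 2 / ((1 - 2 * gf 1 z) * discRoot z)

/-- The part of `RR` that is analytic in the disc `|z| < 4/25`. -/
noncomputable def regularPart (z : ℂ) : ℂ :=
  leadFactor z * (discRoot z / 2) +
    ((1 - gf 1 z) * (2 * gf rho₁ z * (gf rho₁ z + gf rho₂ z)) / discRoot z +
      2 * (gf rho₁ z + gf rho₂ z) * gf rho₂ z) / (1 - 2 * gf 1 z)

theorem differentiableOn_leadFactor :
    DifferentiableOn ℂ leadFactor (Metric.ball 0 (4 / 25)) := by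
  have h1 := differentiableOn_gf_one
  have h2 := differentiableOn_discRoot
  refine DifferentiableOn.div (by fun_prop) (by fun_prop) fun z hz => ?_
  exact mul_ne_zero (one_sub_two_mul_gf_ne_zero (norm_le_of_mem_ball hz))
    (discRoot_ne_zero (by simpa using hz))

theorem differentiableOn_regularPart :
    DifferentiableOn ℂ regularPart (Metric.ball 0 (4 / 25)) := by
  have h1 := differentiableOn_gf_one
  have h2 := differentiableOn_discRoot
  have h3 := differentiableOn_gf_rho₁
  have h4 := differentiableOn_gf_rho₂
  have h5 := differentiableOn_leadFactor
  refine DifferentiableOn.add (by fun_prop) (DifferentiableOn.div (DifferentiableOn.add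
    (DifferentiableOn.div (by fun_prop) h2 fun z hz => discRoot_ne_zero (by simpa using hz))
    (by fun_prop)) (by fun_prop) fun z hz => ?_)
  exact one_sub_two_mul_gf_ne_zero (norm_le_of_mem_ball hz)

theorem hasSqrtForm_RR :
    HasSqrtForm RR (8 / 81) (4 / 25) regularPart
      (fun z => leadFactor z * (-(1 / 2) * sqrtFactor z)) where
  ne_zero := by norm_num
  norm_lt := by norm_num
  diff_left := differentiableOn_regularPart
  diff_right := differentiableOn_leadFactor.mul (differentiableOn_sqrtFactor.const_mul _)
  eq z hz := by
    have hz' : ‖z‖ < 8 / 81 := by simpa using hz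
    rw [RR_eq hz', gf_rho₁₁_eq' hz', regularPart, leadFactor]
    ring

section values

theorem sqrt_two_sq : (((√2 : ℝ)) : ℂ) ^ 2 = 2 := by
  exact_mod_cast Real.sq_sqrt (show (0 : ℝ) ≤ 2 by norm_num)

theorem gf_one_at : gf 1 (8 / 81) = 1 / 9 := by
  have hz : ‖(8 / 81 : ℂ)‖ ≤ 4 / 25 := by norm_num
  have h := gf_one_eq' hz
  have h1 : (gf 1 (8 / 81) - 1 / 9) * (gf 1 (8 / 81) - 8 / 9) = 0 := by linear_combination h
  rcases mul_eq_zero.1 h1 with h2 | h2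
  · exact sub_eq_zero.1 h2
  · exact absurd (sub_eq_zero.1 h2) (gf_one_ne hz (by norm_num))

theorem discRoot_at : discRoot (8 / 81) = ((4 * √2 / 9 : ℝ) : ℂ) := by
  have hz : ‖(8 / 81 : ℂ)‖ ≤ 8 / 81 := by norm_num
  have h := discRoot_sq (z := 8 / 81) (by norm_num)
  rw [gf_one_at] at h
  have h1 : discRoot (8 / 81) ^ 2 = ((4 * √2 / 9 : ℝ) : ℂ) ^ 2 := by
    rw [h]
    push_cast
    linear_combination -(16 / 81 : ℂ) * sqrt_two_sq
  rcases sq_eq_sq_iff_eq_or_eq_neg.1 h1 with h2 | h2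
  · exact h2
  · have h3 := congrArg Complex.re h2
    have h4 := (Complex.re_le_norm _).trans (norm_gf_le dominates_rho₁_at_eight_div hz)
    rw [Complex.neg_re, Complex.ofReal_re, discRoot, gf_one_at] at h3
    simp at h3
    have h5 : 0 < √2 := by positivity
    linarith

theorem gf_rho₁_at : gf rho₁ (8 / 81) = (((4 - 2 * √2) / 9 : ℝ) : ℂ) := by
  have h := discRoot_at
  rw [discRoot, gf_one_at] at h
  push_cast at h ⊢
  linear_combination -(1 / 2 : ℂ) * h

theorem gf_rho₂_at : gf rho₂ (8 / 81) = (((4 - 2 * √2) / 63 : ℝ) : ℂ) := by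
  have h := gf_rho₂_eq' (z := 8 / 81) (by norm_num)
  rw [gf_one_at, gf_rho₁_at] at h
  push_cast at h ⊢
  linear_combination (9 / 7 : ℂ) * h

theorem sqrtFactor_at : sqrtFactor (8 / 81) = ((8 / (3 * √7) : ℝ) : ℂ) := by
  have h7 : (0 : ℝ) < √7 := by positivity
  have h : sqrtFactorSq (8 / 81) = ((8 / (3 * √7) : ℝ) : ℂ) ^ 2 := by
    have h1 : (8 / (3 * √7)) ^ 2 = (64 / 63 : ℝ) := by
      rw [div_pow, mul_pow, Real.sq_sqrt (by norm_num)]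
      norm_num
    rw [sqrtFactorSq, gf_one_at, ← Complex.ofReal_pow, h1]
    norm_num
  rw [sqrtFactor, h, cpow_half_sq]
  rw [Complex.ofReal_re]
  positivity

theorem leadFactor_at : leadFactor (8 / 81) = ((8 * √2 / 7 : ℝ) : ℂ) := by
  have h := sqrt_two_sq
  have h0 : ((√2 : ℝ) : ℂ) ≠ 0 := by
    rintro h1
    norm_num [h1] at h
  rw [leadFactor, gf_one_at, discRoot_at]
  push_cast
  field_simp
  rw [h]
  norm_num

theorem RR₁₁_coeff_at : -(1 / 2) * sqrtFactor (8 / 81) = ((-(4 / (3 * √7)) : ℝ) : ℂ) := by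
  rw [sqrtFactor_at]
  push_cast
  ring

theorem RR_coeff_at : leadFactor (8 / 81) * (-(1 / 2) * sqrtFactor (8 / 81)) =
    ((-(32 * √14 / 147) : ℝ) : ℂ) := by
  rw [RR₁₁_coeff_at, leadFactor_at, ← Complex.ofReal_mul]
  congr 1
  have h7 : (0 : ℝ) < √7 := by positivity
  have h : √14 = √2 * √7 := by
    rw [← Real.sqrt_mul (by norm_num)]
    norm_num
  rw [h]
  field_simp
  rw [Real.sq_sqrt (by norm_num)]
  norm_num

theorem regularPart_at : regularPart (8 / 81) = (((2432 * √2 - 1632) / 3087 : ℝ) : ℂ) := by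
  have h := sqrt_two_sq
  rw [regularPart, leadFactor_at, discRoot_at, gf_one_at, gf_rho₁_at, gf_rho₂_at]
  push_cast
  generalize ((√2 : ℝ) : ℂ) = s at h ⊢
  have h0 : s ≠ 0 := by
    rintro rfl
    norm_num at h
  have hinv (x : ℂ) : x / (4 * s / 9) = x * (9 * s / 8) := by
    rw [div_eq_iff (by simp [h0])]
    linear_combination -(x / 2) * h
  rw [hinv]
  linear_combination (448 * s - 944) / 3087 * h

end values

end PlaneTree

/-! ### The number of trees -/

namespace PlaneTree

/-- The finite set of the trees with `n` vertices. -/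
noncomputable def treesEq (n : ℕ) : Finset PlaneTree := (finite_setOf_order_eq n).toFinset

@[simp] theorem mem_treesEq {n : ℕ} {T : PlaneTree} : T ∈ treesEq n ↔ T.order = n := by
  simp [treesEq]

theorem coe_treesEq (n : ℕ) : (treesEq n : Set PlaneTree) = {T | T.order = n} := by
  simp [treesEq]

/-- The coefficient of `z^n` in the generating function of the index `X`. -/
noncomputable def coeff (X : PlaneTree → ℕ) (n : ℕ) : ℕ := ∑ T ∈ treesEq n, X T

theorem sum_treesEq_term {R : Type*} [CommSemiring R] (X : PlaneTree → ℕ) (z : R) (n : ℕ) :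
    ∑ T ∈ treesEq n, term X z T = coeff X n * z ^ n := by
  rw [coeff, Nat.cast_sum, Finset.sum_mul]
  refine Finset.sum_congr rfl fun T hT => ?_
  rw [term, mem_treesEq.1 hT]

theorem hasSum_coeff {X : PlaneTree → ℕ} {z : ℂ} (hX : Summable fun T => ‖term X z T‖) :
    HasSum (fun n => (coeff X n : ℂ) * z ^ n) (gf X z) := by
  have h (n : ℕ) : ∑' T : order ⁻¹' {n}, term X z T = coeff X n * z ^ n := by
    have h1 : order ⁻¹' {n} = (treesEq n : Set PlaneTree) := by
      ext T
      simp
    rw [h1, Finset.tsum_subtype', sum_treesEq_term]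
  simpa only [h] using (hasSum_term hX).tsum_fiberwise order

/-- The binary tree with subtrees `a` and `b` encodes the plane tree whose first branch is
encoded by `a` and whose remaining part is encoded by `b`. -/
def ofBinaryTree : BinaryTree Unit → PlaneTree
  | .nil => leaf
  | .node _ a b => graft (ofBinaryTree a) (ofBinaryTree b)

theorem order_ofBinaryTree (t : BinaryTree Unit) : (ofBinaryTree t).order = t.numNodes + 1 := by
  induction t with
  | nil => simp [ofBinaryTree, order_leaf]
  | node _ a b ha hb =>
    simp only [ofBinaryTree, order_graft, ha, hb, BinaryTree.numNodes]
    omega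

theorem ofBinaryTree_injective : Function.Injective ofBinaryTree := by
  intro s
  induction s with
  | nil =>
    rintro (_ | ⟨_, a, b⟩) h
    · rfl
    · exact absurd h.symm (graft_ne_leaf _ _)
  | node _ a b ha hb =>
    rintro (_ | ⟨_, a', b'⟩) h
    · exact absurd h (graft_ne_leaf _ _)
    · have := graft_injective (a₁ := (_, _)) (a₂ := (_, _)) h
      rw [Prod.mk.injEq] at this
      rw [ha this.1, hb this.2]

theorem ofBinaryTree_surjective : Function.Surjective ofBinaryTree := by
  intro T
  induction T using induction_graft with
  | h0 => exact ⟨.nil, rfl⟩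
  | h1 a b ha hb =>
    obtain ⟨s, rfl⟩ := ha
    obtain ⟨t, rfl⟩ := hb
    exact ⟨.node () s t, rfl⟩

theorem coeff_one_zero : coeff 1 0 = 0 := by
  refine Finset.sum_eq_zero fun T hT => ?_
  have := order_pos T
  rw [mem_treesEq] at hT
  omega

theorem coeff_one_eq_card (n : ℕ) : coeff 1 n = (treesEq n).card := by
  simp [coeff]

/-- The plane trees with `n + 1` vertices are counted by the Catalan number `C_n`. -/
theorem coeff_one_succ (n : ℕ) : coeff 1 (n + 1) = catalan n := by
  rw [coeff_one_eq_card, ← BinaryTree.treesOfNumNodesEq_card_eq_catalan]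
  symm
  refine Finset.card_bij (fun t _ => ofBinaryTree t) (fun t ht => ?_)
    (fun _ _ _ _ h => ofBinaryTree_injective h) fun T hT => ?_
  · rw [mem_treesEq, order_ofBinaryTree, BinaryTree.mem_treesOfNumNodesEq.1 ht]
  · obtain ⟨t, rfl⟩ := ofBinaryTree_surjective T
    refine ⟨t, ?_, rfl⟩
    rw [mem_treesEq, order_ofBinaryTree] at hT
    rw [BinaryTree.mem_treesOfNumNodesEq]
    omega

/-- The recursion `(n + 1) c_{n+1} = (4n - 2) c_n` for the number `c_n` of trees with `n`
vertices, a shifted Catalan number. -/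
theorem succ_mul_coeff_one_succ {n : ℕ} (hn : 0 < n) :
    ((n : ℝ) + 1) * coeff 1 (n + 1) = (4 * n - 2) * coeff 1 n := by
  obtain ⟨m, rfl⟩ := Nat.exists_eq_succ_of_ne_zero hn.ne'
  have h1 := succ_mul_catalan_eq_centralBinom m
  have h2 := succ_mul_catalan_eq_centralBinom (m + 1)
  have h3 := Nat.succ_mul_centralBinom_succ m
  rw [← h1, ← h2] at h3
  have h4 : (m + 1 + 1) * catalan (m + 1) = 2 * (2 * m + 1) * catalan m :=
    Nat.eq_of_mul_eq_mul_left m.succ_pos (by rw [Nat.succ_eq_add_one, h3]; ring)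
  have h5 : ((m : ℝ) + 1 + 1) * catalan (m + 1) = 2 * (2 * m + 1) * catalan m := by
    exact_mod_cast h4
  rw [Nat.succ_eq_add_one, coeff_one_succ, coeff_one_succ]
  push_cast
  linear_combination h5

theorem coeff_one_pos {n : ℕ} (hn : 0 < n) : 0 < coeff 1 n := by
  induction n, hn using Nat.le_induction with
  | base => simp [coeff_one_succ]
  | succ n hn ih =>
    have h := succ_mul_coeff_one_succ hn
    have h1 : (0 : ℝ) < coeff 1 n := by exact_mod_cast ih
    have h2 : (1 : ℝ) ≤ n := by exact_mod_cast hn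
    have h3 : (0 : ℝ) < (n + 1) * coeff 1 (n + 1) := by
      rw [h]
      exact mul_pos (by linarith) h1
    exact_mod_cast pos_of_mul_pos_right h3 (by positivity)

/-- The true order of `c_n / 4^n` is `n^(-3/2)`; the factor `n²` is enough to make it
monotone. -/
theorem monotone_sq_mul_coeff_one :
    Monotone fun n : ℕ => (n : ℝ) ^ 2 * coeff 1 n / 4 ^ n := by
  refine monotone_nat_of_le_succ fun n => ?_
  rcases n.eq_zero_or_pos with rfl | hn
  · simp
    positivity
  have h := succ_mul_coeff_one_succ hn
  have h2 : (1 : ℝ) ≤ n := by exact_mod_cast hn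
  have h1 : (0 : ℝ) ≤ coeff 1 n := by positivity
  rw [div_le_div_iff₀ (by positivity) (by positivity), pow_succ (4 : ℝ) n]
  have h3 : ((n + 1 : ℕ) : ℝ) ^ 2 * coeff 1 (n + 1) = (n + 1) * ((4 * n - 2) * coeff 1 n) := by
    rw [← h]
    push_cast
    ring
  rw [h3]
  have h4 : (n : ℝ) ^ 2 * 4 ≤ (n + 1) * (4 * n - 2) := by nlinarith
  have := mul_le_mul_of_nonneg_right h4
    (mul_nonneg h1 (pow_nonneg (show (0 : ℝ) ≤ 4 by norm_num) n))
  linarith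

theorem four_pow_le {n : ℕ} (hn : 0 < n) : (4 : ℝ) ^ n ≤ 4 * n ^ 2 * coeff 1 n := by
  have := monotone_sq_mul_coeff_one (show 1 ≤ n from hn)
  simp only [coeff_one_succ 0] at this
  rw [le_div_iff₀ (by positivity)] at this
  norm_num at this
  linarith

/-- A bound for the ratios `c_{n-k} / c_n` that is uniform in `n`. It also holds for `k ≥ n`, with
truncated subtraction, since `c_0 = 0`. -/
theorem coeff_one_sub_div_le (n k : ℕ) :
    (coeff 1 (n - k) : ℝ) / coeff 1 n ≤ (k + 1) ^ 2 * (1 / 4) ^ k := by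
  rcases Nat.eq_zero_or_pos (n - k) with h0 | h0
  · rw [h0, coeff_one_zero, Nat.cast_zero, zero_div]
    positivity
  obtain ⟨m, rfl⟩ : ∃ m, n = m + k := ⟨n - k, by omega⟩
  rw [Nat.add_sub_cancel] at h0 ⊢
  have hmono := monotone_sq_mul_coeff_one (show m ≤ m + k by omega)
  have hc : (0 : ℝ) < coeff 1 (m + k) := by exact_mod_cast coeff_one_pos (by omega)
  have hm : (1 : ℝ) ≤ m := by exact_mod_cast h0
  simp only [pow_add] at hmono
  rw [div_le_div_iff₀ (by positivity) (by positivity)] at hmono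
  have h4 : (0 : ℝ) < 4 ^ m := by positivity
  have h5 : (m : ℝ) ^ 2 * coeff 1 m * 4 ^ k ≤ ((m + k : ℕ) : ℝ) ^ 2 * coeff 1 (m + k) := by
    refine le_of_mul_le_mul_right ?_ h4
    linarith
  have h6 : ((m + k : ℕ) : ℝ) ≤ m * (k + 1) := by
    push_cast
    have : (0 : ℝ) ≤ k := by positivity
    nlinarith
  have h7 : ((m + k : ℕ) : ℝ) ^ 2 * coeff 1 (m + k) ≤ (m * (k + 1)) ^ 2 * coeff 1 (m + k) := by
    gcongr
  rw [div_le_iff₀ hc, one_div, inv_pow]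
  have h8 : (coeff 1 m : ℝ) * 4 ^ k ≤ (k + 1) ^ 2 * coeff 1 (m + k) := by
    refine le_of_mul_le_mul_left ?_ (show (0 : ℝ) < m ^ 2 by positivity)
    linarith
  rw [mul_right_comm, ← div_eq_mul_inv, le_div_iff₀ (by positivity)]
  exact h8

theorem tendsto_coeff_one_div_succ :
    Tendsto (fun n : ℕ => (coeff 1 n : ℝ) / coeff 1 (n + 1)) atTop (𝓝 (1 / 4)) := by
  have h : Tendsto (fun n : ℕ => 1 / 4 + (3 / 2 : ℝ) * (4 * (n : ℝ) - 2)⁻¹) atTop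
      (𝓝 (1 / 4 + 3 / 2 * 0)) := by
    refine tendsto_const_nhds.add (Tendsto.const_mul _ (tendsto_inv_atTop_zero.comp ?_))
    exact tendsto_atTop_add_const_right _ _
      (tendsto_natCast_atTop_atTop.const_mul_atTop (by norm_num))
  rw [mul_zero, add_zero] at h
  refine h.congr' ?_
  filter_upwards [eventually_gt_atTop 0] with n hn
  have h1 := succ_mul_coeff_one_succ hn
  have h2 : (1 : ℝ) ≤ n := by exact_mod_cast hn
  have hc : (0 : ℝ) < coeff 1 (n + 1) := by exact_mod_cast coeff_one_pos (by omega)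
  have h3 : (4 * (n : ℝ) - 2) ≠ 0 := by linarith
  rw [eq_div_iff hc.ne']
  have h4 : (coeff 1 n : ℝ) = (n + 1) * coeff 1 (n + 1) / (4 * n - 2) := by
    rw [eq_div_iff h3]
    linarith
  rw [h4]
  field_simp
  ring

theorem tendsto_coeff_one_sub_div (k : ℕ) :
    Tendsto (fun n : ℕ => (coeff 1 (n - k) : ℝ) / coeff 1 n) atTop (𝓝 ((1 / 4) ^ k)) := by
  rw [← tendsto_add_atTop_iff_nat k]
  simp only [Nat.add_sub_cancel]
  induction k with
  | zero =>
    refine tendsto_const_nhds.congr' ?_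
    filter_upwards [eventually_gt_atTop 0] with n hn
    have hc : (coeff 1 n : ℝ) ≠ 0 := by exact_mod_cast (coeff_one_pos hn).ne'
    simp [hc]
  | succ k ih =>
    have h := ih.mul (tendsto_coeff_one_div_succ.comp (tendsto_add_atTop_nat k))
    rw [← pow_succ] at h
    refine h.congr' ?_
    filter_upwards [eventually_gt_atTop 0] with n hn
    have hc : (coeff 1 (n + k) : ℝ) ≠ 0 := by exact_mod_cast (coeff_one_pos (by omega)).ne'
    simp only [Function.comp_apply]
    rw [div_mul_div_cancel₀ hc, add_assoc]

end PlaneTree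

/-! ### Asymptotics of coefficients -/

/-- The coefficients of a power series that converges to `f` near `0` are determined by `f`. -/
theorem eq_of_eventually_hasSum {f : ℂ → ℂ} {a b : ℕ → ℂ}
    (ha : ∀ᶠ z in 𝓝 (0 : ℂ), HasSum (fun n => a n * z ^ n) (f z))
    (hb : ∀ᶠ z in 𝓝 (0 : ℂ), HasSum (fun n => b n * z ^ n) (f z)) : a = b := by
  have key (c : ℕ → ℂ) (hc : ∀ᶠ z in 𝓝 (0 : ℂ), HasSum (fun n => c n * z ^ n) (f z)) :
      HasFPowerSeriesAt f (FormalMultilinearSeries.ofScalars ℂ c) 0 := by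
    rw [hasFPowerSeriesAt_iff]
    filter_upwards [hc] with z hz
    simpa [FormalMultilinearSeries.coeff_ofScalars, mul_comm] using hz
  have h := (key a ha).eq_formalMultilinearSeries (key b hb)
  ext n
  have := congrArg (fun p => p.coeff n) h
  simpa only [FormalMultilinearSeries.coeff_ofScalars] using this

/-- The Taylor series at `0` of a function that is holomorphic in a disc. -/
theorem exists_hasSum_of_differentiableOn {f : ℂ → ℂ} {r : ℝ}
    (hf : DifferentiableOn ℂ f (Metric.ball 0 r)) :
    ∃ a : ℕ → ℂ, ∀ z : ℂ, ‖z‖ < r → HasSum (fun n => a n * z ^ n) (f z) := by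
  refine ⟨fun n => (n.factorial : ℂ)⁻¹ * iteratedDeriv n f 0, fun z hz => ?_⟩
  have := Complex.hasSum_taylorSeries_on_ball hf (z := z) (by simpa using hz)
  simpa only [sub_zero, smul_eq_mul, mul_assoc, mul_comm (z ^ _)] using this

/-- Inside the disc of convergence, power series converge absolutely, even after multiplication
of the coefficients with a polynomial. -/
theorem summable_pow_mul_norm_mul_pow {a : ℕ → ℂ} {z : ℂ} {s : ℝ} (h0 : 0 ≤ s) (hs : s < ‖z‖)
    (h : Summable fun n => a n * z ^ n) (m : ℕ) :
    Summable fun n : ℕ => ((n : ℝ) + 1) ^ m * (‖a n‖ * s ^ n) := by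
  obtain ⟨B, hB⟩ := h.tendsto_atTop_zero.norm.bddAbove_range
  have hz : 0 < ‖z‖ := h0.trans_lt hs
  have hq : ‖s / ‖z‖‖ < 1 := by
    rw [Real.norm_of_nonneg (by positivity)]
    exact (div_lt_one hz).2 hs
  have hsum : Summable fun n : ℕ => B * (2 ^ m * ((n : ℝ) ^ m * (s / ‖z‖) ^ n)) +
      B * (2 ^ m * (s / ‖z‖) ^ n) :=
    (((summable_pow_mul_geometric_of_norm_lt_one m hq).mul_left _).mul_left _).add
      (((summable_geometric_of_norm_lt_one hq).mul_left _).mul_left _)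
  refine Summable.of_nonneg_of_le (fun n => by positivity) (fun n => ?_) hsum
  have h1 : ‖a n‖ * ‖z‖ ^ n ≤ B := by
    have := hB ⟨n, rfl⟩
    simpa using this
  have hB0 : 0 ≤ B := le_trans (by positivity) h1
  have h2 : ‖a n‖ * s ^ n = ‖a n‖ * ‖z‖ ^ n * (s / ‖z‖) ^ n := by
    rw [div_pow]
    field_simp
  have h3 : ((n : ℝ) + 1) ^ m ≤ 2 ^ m * (n : ℝ) ^ m + 2 ^ m := by
    rcases n.eq_zero_or_pos with rfl | hn
    · have : (1 : ℝ) ≤ 2 ^ m := one_le_pow₀ (by norm_num)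
      have : (0 : ℝ) ≤ 2 ^ m * 0 ^ m := by positivity
      simp only [Nat.cast_zero, zero_add, one_pow]
      linarith
    · have h4 : (1 : ℝ) ≤ n := by exact_mod_cast hn
      have h5 : ((n : ℝ) + 1) ^ m ≤ (2 * n) ^ m := by
        gcongr
        linarith
      rw [mul_pow] at h5
      have : (0 : ℝ) ≤ 2 ^ m := by positivity
      linarith
  have hs' : 0 ≤ (s / ‖z‖) ^ n := by positivity
  calc ((n : ℝ) + 1) ^ m * (‖a n‖ * s ^ n)
      = ((n : ℝ) + 1) ^ m * (‖a n‖ * ‖z‖ ^ n * (s / ‖z‖) ^ n) := by rw [h2]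
    _ ≤ (2 ^ m * (n : ℝ) ^ m + 2 ^ m) * (B * (s / ‖z‖) ^ n) := by gcongr
    _ = _ := by ring

namespace PlaneTree

/-- The coefficients of `√(1 - 81z/8)` are those of `1 - 2 C(81z/32)`, where `C` is the
generating function of all trees. -/
theorem cpow_half_eq {z : ℂ} (hz : ‖81 / 32 * z‖ ≤ 4 / 25) :
    (1 - z / (8 / 81)) ^ (1 / 2 : ℂ) = 1 - 2 * gf 1 (81 / 32 * z) := by
  have h := gf_one_eq' hz
  have h1 : 1 - z / (8 / 81) = (1 - 2 * gf 1 (81 / 32 * z)) ^ 2 := by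
    linear_combination -4 * h
  rw [h1, cpow_half_sq]
  have h2 := (Complex.re_le_norm _).trans (norm_gf_one_le hz)
  simp
  linarith

/-- `c_n x^n` outgrows `4^n` for `x > 1`, as `c_n` is at least `4^n / (4n²)`. -/
theorem tendsto_four_pow_div_coeff_one_mul_pow {x : ℝ} (hx : 1 < x) :
    Tendsto (fun n : ℕ => 4 ^ n / (coeff 1 n * x ^ n)) atTop (𝓝 0) := by
  have hq : ‖x⁻¹‖ < 1 := by
    rw [norm_inv, Real.norm_of_nonneg (by linarith)]
    exact inv_lt_one_of_one_lt₀ hx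
  have h := ((summable_pow_mul_geometric_of_norm_lt_one 2 hq).mul_left 4).tendsto_atTop_zero
  refine squeeze_zero' (Eventually.of_forall fun n => by positivity) ?_ h
  filter_upwards [eventually_gt_atTop 0] with n hn
  have hc : (0 : ℝ) < coeff 1 n := by exact_mod_cast coeff_one_pos hn
  rw [div_le_iff₀ (by positivity), inv_pow]
  have : 4 * ((n : ℝ) ^ 2 * (x ^ n)⁻¹) * (coeff 1 n * x ^ n) = 4 * n ^ 2 * coeff 1 n := by
    have : x ^ n ≠ 0 := by positivity
    field_simp
  rw [this]
  exact four_pow_le hn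

end PlaneTree

open PlaneTree in
/-- The coefficients of a function of the form `E(z) + F(z) √(1 - z/z₀)` with `z₀ = 8/81` are,
relative to `c_n (81/32)^n`, where `c_n` is the number of trees with `n` vertices, asymptotically
`-2 F(z₀)`. -/
theorem HasSqrtForm.tendsto_coeff {f E F : ℂ → ℂ} {r : ℝ} (h : HasSqrtForm f (8 / 81) r E F)
    {a : ℕ → ℂ} (ha : ∀ᶠ z in 𝓝 (0 : ℂ), HasSum (fun n => a n * z ^ n) (f z)) :
    Tendsto (fun n => a n / (coeff 1 n * (81 / 32) ^ n)) atTop (𝓝 (-2 * F (8 / 81))) := by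
  obtain ⟨e, he⟩ := exists_hasSum_of_differentiableOn h.diff_left
  obtain ⟨φ, hφ⟩ := exists_hasSum_of_differentiableOn h.diff_right
  have hr : 8 / 81 < r := by simpa using h.norm_lt
  obtain ⟨t, ht, htr⟩ := exists_between hr
  have ht0 : 0 < t := by linarith
  have hnt : ‖(t : ℂ)‖ = t := by simp [ht0.le]
  set q : ℂ := 81 / 32 with hq
  have hq0 : q ≠ 0 := by norm_num [hq]
  -- The coefficients of the product are convolutions.
  have ha' : a = fun n => e n + φ n -
      2 * ∑ kl ∈ Finset.HasAntidiagonal.antidiagonal n, φ kl.1 * (coeff 1 kl.2 * q ^ kl.2) := by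
    refine eq_of_eventually_hasSum ha ?_
    have hb : Metric.ball (0 : ℂ) (1 / 20) ∈ 𝓝 0 := Metric.ball_mem_nhds _ (by norm_num)
    filter_upwards [hb] with z hz
    have hz' : ‖z‖ < 1 / 20 := by simpa using hz
    have hqz : ‖q * z‖ ≤ 4 / 25 := by
      rw [norm_mul, show ‖q‖ = 81 / 32 by norm_num [hq]]
      linarith
    rw [h.eq z (by norm_num; linarith), cpow_half_eq hqz]
    have h1 := he z (by linarith)
    have h2 := hφ z (by linarith)
    have h3 := hasSum_coeff (dominates_one_at_four_div.summable_norm hqz)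
    have hn2 := h2.summable.norm
    have hn3 := h3.summable.norm
    have h4 : HasSum (fun n => ∑ kl ∈ Finset.HasAntidiagonal.antidiagonal n,
        (φ kl.1 * z ^ kl.1) * (coeff 1 kl.2 * (q * z) ^ kl.2)) (F z * gf 1 (q * z)) := by
      rw [← h2.tsum_eq, ← h3.tsum_eq,
        tsum_mul_tsum_eq_tsum_sum_antidiagonal_of_summable_norm hn2 hn3]
      exact (summable_norm_sum_mul_antidiagonal_of_summable_norm hn2 hn3).of_norm.hasSum
    have hval : E z + F z * (1 - 2 * gf 1 (q * z)) =
        E z + F z - 2 * (F z * gf 1 (q * z)) := by ring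
    have hterm (n : ℕ) : (e n + φ n - 2 * ∑ kl ∈ Finset.HasAntidiagonal.antidiagonal n,
        φ kl.1 * (coeff 1 kl.2 * q ^ kl.2)) * z ^ n = e n * z ^ n + φ n * z ^ n -
          2 * ∑ kl ∈ Finset.HasAntidiagonal.antidiagonal n,
            (φ kl.1 * z ^ kl.1) * (coeff 1 kl.2 * (q * z) ^ kl.2) := by
      rw [sub_mul, add_mul, mul_assoc 2, Finset.sum_mul]
      congr 2
      refine Finset.sum_congr rfl fun kl hkl => ?_
      rw [← Finset.HasAntidiagonal.mem_antidiagonal.1 hkl, mul_pow, pow_add]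
      ring
    rw [hval]
    simp only [hterm]
    exact (h1.add h2).sub (h4.mul_left 2)
  -- The coefficients of `E` and `F` are negligible: they are `O(t^(-n))`, and `t > 8/81`.
  have hsmall (b : ℕ → ℂ) (hb : Summable fun n => b n * (t : ℂ) ^ n) :
      Tendsto (fun n => b n / (coeff 1 n * q ^ n)) atTop (𝓝 0) := by
    have h1 := hb.tendsto_atTop_zero
    have h2 := tendsto_four_pow_div_coeff_one_mul_pow (x := 81 / 8 * t) (by linarith)
    have h3 := h1.mul ((Complex.continuous_ofReal.tendsto 0).comp h2)
    rw [Complex.ofReal_zero, mul_zero] at h3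
    refine h3.congr fun n => ?_
    simp only [Function.comp_apply]
    push_cast
    have h4 : (81 / 8 * (t : ℂ)) = 4 * (q * t) := by rw [hq]; ring
    have h5 : (t : ℂ) ^ n ≠ 0 := pow_ne_zero _ (by exact_mod_cast ht0.ne')
    rw [h4, mul_pow, mul_pow]
    rcases eq_or_ne (coeff 1 n : ℂ) 0 with h0 | h0
    · simp [h0]
    field_simp
  -- The main term of the convolution, divided by `c_n q^n`; note that `q⁻¹ = (8/81) * 4`. The sum
  -- over all `k` is a sum over `k < n`, since `c_0 = 0`.
  have hmain : Tendsto (fun n => ∑' k, φ k * (8 / 81) ^ k *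
      (4 ^ k * ((coeff 1 (n - k) : ℂ) / coeff 1 n))) atTop (𝓝 (∑' k, φ k * (8 / 81) ^ k)) := by
    refine tendsto_tsum_of_dominated_convergence
      (summable_pow_mul_norm_mul_pow (s := 8 / 81) (z := t) (by norm_num) (by rwa [hnt])
        (hφ t (by rwa [hnt])).summable 2) (fun k => ?_) (Eventually.of_forall fun n k => ?_)
    · have h1 := (Complex.continuous_ofReal.tendsto _).comp (tendsto_coeff_one_sub_div k)
      have h2 := (h1.const_mul ((4 : ℂ) ^ k)).const_mul (φ k * (8 / 81) ^ k)
      convert h2 using 2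
      · simp
      · push_cast
        rw [← mul_pow]
        norm_num
    · have h1 := coeff_one_sub_div_le n k
      have h2 : ‖(4 : ℂ) ^ k * ((coeff 1 (n - k) : ℂ) / coeff 1 n)‖ ≤ ((k : ℝ) + 1) ^ 2 := by
        rw [norm_mul, norm_pow, norm_div, Complex.norm_natCast, Complex.norm_natCast]
        calc ‖(4 : ℂ)‖ ^ k * ((coeff 1 (n - k) : ℝ) / coeff 1 n)
            ≤ ‖(4 : ℂ)‖ ^ k * ((k + 1) ^ 2 * (1 / 4) ^ k) := by gcongr
          _ = ((k : ℝ) + 1) ^ 2 := by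
            rw [mul_left_comm, ← mul_pow]
            norm_num
      rw [norm_mul, mul_comm]
      refine mul_le_mul h2 ?_ (norm_nonneg _) (by positivity)
      rw [norm_mul, norm_pow]
      norm_num
  rw [(hφ (8 / 81) (by simpa using hr)).tsum_eq] at hmain
  have hlim := ((hsmall e (he t (by rwa [hnt])).summable).add
    (hsmall φ (hφ t (by rwa [hnt])).summable)).sub (hmain.const_mul 2)
  rw [add_zero, zero_sub, ← neg_mul] at hlim
  refine hlim.congr fun n => ?_
  rw [ha']
  simp only [sub_div, add_div, mul_div_assoc]
  congr 2
  rw [tsum_eq_sum (s := Finset.range (n + 1)), Finset.sum_div,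
    Finset.Nat.sum_antidiagonal_eq_sum_range_succ_mk]
  · refine Finset.sum_congr rfl fun k hk => ?_
    obtain ⟨m, rfl⟩ : ∃ m, n = k + m := ⟨n - k, by rw [Finset.mem_range] at hk; omega⟩
    simp only [Nat.add_sub_cancel_left, pow_add]
    have h8 : (8 / 81 : ℂ) ^ k * 4 ^ k = (q ^ k)⁻¹ := by
      rw [← mul_pow, ← inv_pow, hq]
      norm_num
    rw [← mul_assoc, mul_assoc (φ k), h8]
    have := pow_ne_zero k hq0
    have := pow_ne_zero m hq0
    rcases eq_or_ne (coeff 1 (k + m) : ℂ) 0 with h0 | h0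
    · simp [h0]
    field_simp
  · intro k hk
    rw [Finset.mem_range, not_lt] at hk
    rw [Nat.sub_eq_zero_of_le (by omega), coeff_one_zero]
    simp

/-! ### The variance -/

theorem uniformOn_finset_eq_sum_dirac {Ω : Type*} [MeasurableSpace Ω] [MeasurableSingletonClass Ω]
    (s : Finset Ω) :
    uniformOn (s : Set Ω) = (s.card : ENNReal)⁻¹ • ∑ x ∈ s, Measure.dirac x := by
  classical
  rw [uniformOn, ProbabilityTheory.cond, Measure.count_apply_finset]
  congr 1
  ext A hA
  rw [Measure.restrict_apply hA, Measure.finsetSum_apply, Set.inter_comm]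
  have h : (s : Set Ω) ∩ A = ((s.filter (· ∈ A) : Finset Ω) : Set Ω) := by
    ext x
    simp
  rw [h, Measure.count_apply_finset, Finset.card_filter]
  push_cast
  refine Finset.sum_congr rfl fun x _ => ?_
  rw [Measure.dirac_apply' _ hA, Set.indicator_apply]
  simp

theorem integral_uniformOn_finset {Ω : Type*} [MeasurableSpace Ω] [MeasurableSingletonClass Ω]
    (s : Finset Ω) (f : Ω → ℝ) :
    ∫ x, f x ∂(uniformOn (s : Set Ω)) = (∑ x ∈ s, f x) / s.card := by
  rw [uniformOn_finset_eq_sum_dirac, integral_smul_measure,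
    integral_finsetSum_measure fun x _ => integrable_dirac (by simp)]
  simp [div_eq_inv_mul]

theorem integrable_uniformOn_finset {Ω : Type*} [MeasurableSpace Ω] [MeasurableSingletonClass Ω]
    {s : Finset Ω} (hs : s.Nonempty) (f : Ω → ℝ) : Integrable f (uniformOn (s : Set Ω)) := by
  rw [uniformOn_finset_eq_sum_dirac]
  refine Integrable.smul_measure ?_ (by simpa using hs.ne_empty)
  exact integrable_finsetSum_measure.2 fun x _ => integrable_dirac (by simp)

namespace PlaneTree

/-- The variance as the difference of the second moment and the squared mean. -/
theorem varRho_eq {n : ℕ} (hn : 0 < n) :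
    varRho n = coeff (rho * rho) n / coeff 1 n - (coeff rho n / coeff 1 n) ^ 2 := by
  have hne : (treesEq n).Nonempty := by
    rw [← Finset.card_pos, ← coeff_one_eq_card]
    exact coeff_one_pos hn
  have : IsProbabilityMeasure (uniformOn (treesEq n : Set PlaneTree)) :=
    isProbabilityMeasure_uniformOn (treesEq n).finite_toSet hne
  have hmem : MemLp (fun T : PlaneTree => (T.rho : ℝ)) 2
      (uniformOn (treesEq n : Set PlaneTree)) := by
    rw [memLp_two_iff_integrable_sq (integrable_uniformOn_finset hne _).aestronglyMeasurable]
    exact integrable_uniformOn_finset hne _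
  rw [varRho, ← coe_treesEq, variance_eq_sub hmem, integral_uniformOn_finset]
  simp only [Pi.pow_apply]
  rw [integral_uniformOn_finset, ← coeff_one_eq_card, coeff]
  simp [coeff, sq]

theorem coeff_add (X Y : PlaneTree → ℕ) (n : ℕ) : coeff (X + Y) n = coeff X n + coeff Y n := by
  simp [coeff, Finset.sum_add_distrib]

theorem coeff_rho_sq (n : ℕ) : coeff (rho * rho) n =
    coeff (rho₁ * rho₁) n + 2 * coeff (rho₁ * rho₂) n + coeff (rho₂ * rho₂) n := by
  have h : rho * rho = rho₁ * rho₁ + rho₁ * rho₂ + rho₁ * rho₂ + rho₂ * rho₂ := by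
    ext T
    simp only [Pi.mul_apply, Pi.add_apply, rho_eq_add]
    ring
  rw [h, coeff_add, coeff_add, coeff_add]
  ring

theorem hasSum_coeff_RR {z : ℂ} (hz : ‖z‖ ≤ 8 / 81) :
    HasSum (fun n => (coeff (rho * rho) n : ℂ) * z ^ n) (RR z) := by
  obtain ⟨p, hP⟩ := exists_dominates_rho₁₂_at_eight_div
  obtain ⟨s, hS⟩ := exists_dominates_rho₂₂_at_eight_div
  have h := ((hasSum_coeff (dominates_rho₁₁_at_eight_div.summable_norm hz)).add
    ((hasSum_coeff (hP.summable_norm hz)).mul_left 2)).add (hasSum_coeff (hS.summable_norm hz))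
  rw [RR, RR₁₁_eq_gf, RR₁₂_eq_gf, RR₂₂_eq_gf]
  simp only [coeff_rho_sq]
  push_cast
  simpa only [add_mul, mul_assoc] using h

/-- The generating function of `ρ` converges at `4/25`, with a sum of at most `2/5 + 2/15`. -/
theorem coeff_rho_le (n : ℕ) : (coeff rho n : ℝ) ≤ 8 / 15 * (25 / 4) ^ n := by
  have h1 := dominates_rho₁_at_four_div.sum_le (treesEq n)
  have h2 := dominates_rho₂_at_four_div.sum_le (treesEq n)
  rw [sum_treesEq_term] at h1 h2
  have h : rho = rho₁ + rho₂ := funext rho_eq_add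
  rw [h, coeff_add]
  push_cast
  have h3 : (4 / 25 : ℝ) ^ n * (25 / 4) ^ n = 1 := by
    rw [← mul_pow]
    norm_num
  have h4 : ((coeff rho₁ n : ℝ) + coeff rho₂ n) * (4 / 25) ^ n ≤ 8 / 15 := by linarith
  have := mul_le_mul_of_nonneg_right h4 (show (0 : ℝ) ≤ (25 / 4) ^ n by positivity)
  rwa [mul_assoc, h3, mul_one] at this

/-- The squared mean of `ρ_n` is of smaller exponential order than the variance, as
`(25/16)² < 81/32`. -/
theorem tendsto_sq_mean_div :
    Tendsto (fun n : ℕ => ((coeff rho n : ℝ) / coeff 1 n) ^ 2 / (81 / 32) ^ n) atTop (𝓝 0) := by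
  -- `(25/16)² / (81/32) = 20000/20736`
  have h := (summable_pow_mul_geometric_of_norm_lt_one (R := ℝ) 4
    (r := (20000 / 20736)) (by norm_num)).mul_left ((32 / 15) ^ 2) |>.tendsto_atTop_zero
  refine squeeze_zero' (Eventually.of_forall fun n => by positivity) ?_ h
  filter_upwards [eventually_gt_atTop 0] with n hn
  have hc : (0 : ℝ) < coeff 1 n := by exact_mod_cast coeff_one_pos hn
  have h1 : (coeff rho n : ℝ) / coeff 1 n ≤ 32 / 15 * n ^ 2 * (25 / 16) ^ n := by
    rw [div_le_iff₀ hc]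
    have h2 := mul_le_mul_of_nonneg_left (four_pow_le hn)
      (show (0 : ℝ) ≤ 8 / 15 * (25 / 16) ^ n by positivity)
    have h3 : (8 / 15 * (25 / 16) ^ n * 4 ^ n : ℝ) = 8 / 15 * (25 / 4) ^ n := by
      rw [mul_assoc, ← mul_pow]
      norm_num
    rw [h3] at h2
    refine (coeff_rho_le n).trans (h2.trans (le_of_eq ?_))
    ring
  rw [div_le_iff₀ (by positivity)]
  refine (pow_le_pow_left₀ (by positivity) h1 2).trans (le_of_eq ?_)
  have h4 : ((25 / 16 : ℝ) ^ n) ^ 2 = (20000 / 20736) ^ n * (81 / 32) ^ n := by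
    rw [← pow_mul, mul_comm n 2, pow_mul, ← mul_pow]
    norm_num
  rw [mul_pow, h4]
  ring

theorem varRho_isEquivalent :
    varRho ~[atTop] (fun n : ℕ => 64 * √14 / 147 * (81 / 32 : ℝ) ^ n) := by
  have hpos : (0 : ℝ) < 64 * √14 / 147 := by positivity
  rw [isEquivalent_iff_tendsto_one (Eventually.of_forall fun n => by positivity)]
  have h1 : Tendsto (fun n : ℕ => (coeff (rho * rho) n : ℝ) / (coeff 1 n * (81 / 32) ^ n)) atTop
      (𝓝 (64 * √14 / 147)) := by
    have hb : ∀ᶠ z in 𝓝 (0 : ℂ), HasSum (fun n => (coeff (rho * rho) n : ℂ) * z ^ n) (RR z) := by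
      filter_upwards [Metric.ball_mem_nhds (0 : ℂ) (show (0 : ℝ) < 8 / 81 by norm_num)] with z hz
      exact hasSum_coeff_RR (norm_le_of_mem_ball hz)
    have h := hasSqrtForm_RR.tendsto_coeff hb
    rw [RR_coeff_at] at h
    have h' := (Complex.continuous_re.tendsto _).comp h
    convert h' using 2 with n
    · simp only [Function.comp_apply]
      rw [← Complex.ofReal_re ((coeff (rho * rho) n : ℝ) / (coeff 1 n * (81 / 32) ^ n))]
      push_cast
      rfl
    · rw [show (-2 : ℂ) = ((-2 : ℝ) : ℂ) by norm_num, ← Complex.ofReal_mul, Complex.ofReal_re]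
      ring
  have h2 := (h1.sub tendsto_sq_mean_div).div_const (64 * √14 / 147)
  rw [sub_zero, div_self hpos.ne'] at h2
  refine h2.congr' ?_
  filter_upwards [eventually_gt_atTop 0] with n hn
  rw [Pi.div_apply, varRho_eq hn, ← div_div, ← sub_div, div_div, mul_comm ((81 / 32 : ℝ) ^ n)]

end PlaneTree

theorem mainTheorem3 :
    -- the generating functions converge absolutely for `|z| < 8/81`
    (∀ z : ℂ, ‖z‖ < 8 / 81 →
      Summable (PlaneTree.genTerm PlaneTree.rho₁ PlaneTree.rho₁ z) ∧
      Summable (PlaneTree.genTerm PlaneTree.rho₁ PlaneTree.rho₂ z) ∧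
      Summable (PlaneTree.genTerm PlaneTree.rho₂ PlaneTree.rho₂ z)) ∧
    IsSmallestSingularity PlaneTree.RR₁₁ (8 / 81) ∧
    HasSqrtExpansion PlaneTree.RR₁₁ (8 / 81)
      ((2 * √2 / 9 : ℝ) : ℂ) ((-(4 / (3 * √7)) : ℝ) : ℂ) ∧
    IsSmallestSingularity PlaneTree.RR (8 / 81) ∧
    HasSqrtExpansion PlaneTree.RR (8 / 81)
      (((2432 * √2 - 1632) / 3087 : ℝ) : ℂ) ((-(32 * √14 / 147) : ℝ) : ℂ) ∧
    PlaneTree.varRho ~[atTop] (fun n : ℕ => 64 * √14 / 147 * (81 / 32 : ℝ) ^ n) := by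
  have h11 := PlaneTree.hasSqrtForm_RR₁₁.hasSqrtExpansion
  rw [PlaneTree.RR₁₁_coeff_at, PlaneTree.discRoot_at] at h11
  have hRR := PlaneTree.hasSqrtForm_RR.hasSqrtExpansion
  rw [PlaneTree.RR_coeff_at, PlaneTree.regularPart_at] at hRR
  refine ⟨fun z hz => ?_, PlaneTree.hasSqrtForm_RR₁₁.isSmallestSingularity ?_, ?_,
    PlaneTree.hasSqrtForm_RR.isSmallestSingularity ?_, hRR, PlaneTree.varRho_isEquivalent⟩
  · obtain ⟨p, hP⟩ := PlaneTree.exists_dominates_rho₁₂_at_eight_div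
    obtain ⟨s, hS⟩ := PlaneTree.exists_dominates_rho₂₂_at_eight_div
    simp only [PlaneTree.genTerm_eq]
    exact ⟨(PlaneTree.dominates_rho₁₁_at_eight_div.summable_norm hz.le).of_norm,
      (hP.summable_norm hz.le).of_norm, (hS.summable_norm hz.le).of_norm⟩
  · rw [PlaneTree.RR₁₁_coeff_at, Complex.ofReal_ne_zero, neg_ne_zero]
    positivity
  · convert h11 using 1
    push_cast
    ring
  · rw [PlaneTree.RR_coeff_at, Complex.ofReal_ne_zero, neg_ne_zero]
    positivity
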